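/- **Processes.** Fix an infinite set of channels $x,y,z$, a set of tags $a$, and a set of process names $A$. Processes of CaP, taken up to renaming of bound channels, are $$P,Q ::= x\leftrightarrow y \mid \mathsf{close}\,x \mid x!a.P \mid x!(y)[P].Q \mid P\oplus Q \mid \mathsf{done} \mid A\langle \bar x\rangle \mid \mathsf{wait}\,x.P \mid x?\{a_i:P_i\}_{i\in I} \mid x?(y).P \mid (x)(P\mid Q)$$ with $I$ finite and the tags $a_i$ distinct. The new channel $y$ is bound in $P$ (not in $Q$) in $x!(y)[P].Q$, and in $P$ in $x?(y).P$; the channel $x$ is bound in $P$ and $Q$ in $(x)(P\mid Q)$. Each name $A$ has one global definition $A(\bar x)=P$ with $\mathrm{fn}(P)=\{\bar x\}$ and every invocation in $P$ guarded by a prefix or a choice. Buffers are $B_x ::= [\,] \mid x!a.B_x \mid x!(y)[P].B_x$; $B_x[P]$ fills the hole, and $B_y$ is $B_x$ with $x$ replaced by $y$. **Semantics.** $\sqsupseteq$ is the least preorder that is closed under cuts $(x)(\cdot\mid\cdot)$ and under buffers $B_x[\cdot]$ and satisfies (bound channels never being captured nor leaving the scope of their binder): $A\langle\bar x\rangle\sqsupseteq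 P$ if $A(\bar x)=P$; $x\leftrightarrow y\sqsupseteq y\leftrightarrow x$; $(x)(P\mid Q)\sqsupseteq(x)(Q\mid P)$; for $x\neq y$, $(x)(B_x[\mathsf{wait}\,y.P]\mid Q)\sqsupseteq \mathsf{wait}\,y.(x)(B_x[P]\mid Q)$, $(x)(B_x[y?\{a_i:P_i\}_{i\in I}]\mid Q)\sqsupseteq y?\{a_i:(x)(B_x[P_i]\mid Q)\}_{i\in I}$, $(x)(B_x[y?(z).P]\mid Q)\sqsupseteq y?(z).(x)(B_x[P]\mid Q)$, $(x)(B_x[P]\mid B'_x[x\leftrightarrow y])\sqsupseteq B_y[(x)(P\mid B'_x[x\leftrightarrow y])]$, $(x)(y!(z)[P].Q\mid R)\sqsupseteq y!(z)[(x)(P\mid R)].Q$ if $x\in\mathrm{fn}(P)$ and $x\notin\mathrm{fn}(Q)$, $(x)(B_y[P]\mid Q)\sqsupseteq B_y[(x)(P\mid Q)]$ if $x\notin\mathrm{fn}(B_y)$, $B_x[y!(z)[P].Q]\sqsupseteq y!(z)[B_x[P]].Q$ if $x\in\mathrm{fn}(P)$ and $x\notin\mathrm{fn}(Q)$, $B_x[B'_y[P]]\sqsupseteq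 B'_y[B_x[P]]$ if $x\in\mathrm{fn}(P)$ and $x\notin\mathrm{fn}(B'_y)$. The base reductions, with the same convention on bound channels, are $P_1\oplus P_2\to P_k$ ($k\in\{1,2\}$); $(x)(x\leftrightarrow y\mid P)\to P\{y/x\}$; $(x)(\mathsf{close}\,x\mid\mathsf{wait}\,x.P)\to P$; $(x)(x!a_k.P\mid B_x[x?\{a_i:Q_i\}_{i\in I}])\to(x)(P\mid B_x[Q_k])$ for $k\in I$; $(x)(x!(y)[P].Q\mid B_x[x?(y).R])\to(y)(P\mid(x)(Q\mid B_x[R]))$. Reduction $\to$ is the closure of the base reductions under $(x)(\cdot\mid R)$, under buffers $B_x[\cdot]$, and under the rule that $P\sqsupseteq R\to Q$ implies $P\to Q$. **Session types** are the regular, finite or infinite, trees $$S,T ::= \mathbf 1\mid\bot\mid\oplus\{{}^{m_i}a_i:S_i\}_{i\in I}\mid\&\{{}^{m_i}a_i:S_i\}_{i\in I}\mid S\otimes T\mid S⅋T$$ with $I$ finite and nonempty, distinct tags and annotations $m_i\in\mathbb N$; $\mathbf 1,\oplus,\otimes$ are positive; the dual $S^\perp$ exchanges $\mathbf 1/\bot$,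 $\oplus/\&$, $\otimes/⅋$ everywhere. Labels are $!\sigma$ and $?\sigma$ with $\sigma ::= *\mid {}^m a\mid S$. The immediate transitions are $\mathbf 1\xrightarrow{!*}\mathbf 1$, $\oplus\{{}^{m_i}a_i:S_i\}\xrightarrow{!{}^{m_k}a_k}S_k$, $S\otimes T\xrightarrow{!S}T$ and, dually, $\bot\xrightarrow{?*}\bot$, $\&\{{}^{m_i}a_i:S_i\}\xrightarrow{?{}^{m_k}a_k}S_k$, $S⅋T\xrightarrow{?S}T$. The late/early transitions are: if $S_i\xrightarrow{?\sigma}T_i$ for all $i\in I$ then $\oplus\{{}^{m_i}a_i:S_i\}\xrightarrow{?\sigma}\oplus\{{}^{m_i}a_i:T_i\}$; if $T\xrightarrow{?\sigma}T'$ then $S\otimes T\xrightarrow{?\sigma}S\otimes T'$; and dually for $!\sigma$ with $\&$ and $⅋$. These rules are read coinductively, with the requirement that each judgment in a derivation also has a finite derivation in which one may in addition use, for a single $k\in I$: if $S_k\xrightarrow{?\sigma}T_k$ then $\oplus\{{}^{m_i}a_i:S_i\}\xrightarrow{?\sigma}\oplus\{{}^{m_i}a_i:T_i\}$, and dually for $!\sigma$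 and $\&$. $S\bowtie T$ (correct composition) is the largest relation such that $S\bowtie T$ implies: $S$ or $T$ is positive; if $S\xrightarrow{!\sigma}S'$ with $\sigma$ equal to $*$ or an annotated tag, then $T\xrightarrow{?\sigma}T'$ and $S'\bowtie T'$ for some $T'$; if $S\xrightarrow{!S_1}S_2$ then $T\xrightarrow{?T_1}T_2$ with $S_1\bowtie T_1$ and $S_2\bowtie T_2$ for some $T_1,T_2$; and the same two clauses with $S$ and $T$ exchanged. Fair asynchronous subtyping: $S\leqslant T$ iff $R\bowtie T$ implies $R\bowtie S$ for every session type $R$. For contexts (partial maps from channels to session types), $\Delta\leqslant\Gamma$ iff they have the same domain and $\Delta(x)\leqslant\Gamma(x)$ for each $x$ in it. **Typing.** $P\vdash^n\Gamma$, with $n\in\mathbb N$, is defined coinductively by the following rules, where a comma is union of contexts with disjoint domains: $\mathsf{done}\vdash^0\emptyset$; $A\langle\bar x\rangle\vdash^{m+n}\overline{x:S}$ if $A(\bar x)=P$ and $P\vdash^n\overline{x:S}$; $x\leftrightarrow y\vdash^1 x:S,y:T$ if $S^\perp\leqslant T$; $(x)(P\mid Q)\vdash^{m+n}\Gamma,\Delta$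 if $P\vdash^m\Gamma,x:S$, $Q\vdash^n\Delta,x:T$ and $S\bowtie T$; $P_1\oplus P_2\vdash^{1+n_k}\Gamma$ if $k\in\{1,2\}$, $P_1\vdash^{n_1}\Gamma$ and $P_2\vdash^{n_2}\Gamma$; $\mathsf{close}\,x\vdash^1x:\mathbf 1$; $\mathsf{wait}\,x.P\vdash^n\Gamma,x:\bot$ if $P\vdash^n\Gamma$; $x!a_k.P\vdash^{1+m_k+n}\Gamma,x:\oplus\{{}^{m_i}a_i:S_i\}_{i\in I}$ if $k\in I$ and $P\vdash^n\Gamma,x:S_k$; $x?\{a_i:P_i\}_{i\in I}\vdash^n\Gamma,x:\&\{{}^{m_i}a_i:S_i\}_{i\in J}$ if $J\subseteq I$ and $P_i\vdash^{n+m_i}\Gamma,x:S_i$ for all $i\in J$; $x!(y)[P].Q\vdash^{1+m+n}\Gamma,\Delta,x:S\otimes T$ if $P\vdash^m\Gamma,y:S$ and $Q\vdash^n\Delta,x:T$; $x?(y).P\vdash^n\Gamma,x:S⅋T$ if $P\vdash^n\Gamma,y:S,x:T$. **Theorem (subject reduction).** Suppose $P\vdash^n\Gamma$. 1. If $P\to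 Q$, then $Q\vdash^m\Delta$ for some $m$ and some $\Delta\leqslant\Gamma$. 2. If $P\to Q$ by a reduction whose base reduction is not the resolution of a choice, then $Q\vdash^m\Delta$ for some $m<n$ and some $\Delta\leqslant\Gamma$. 3. If $P\to Q_1$ and $P\to Q_2$ are obtained by resolving one and the same choice of $P$ to the left and to the right respectively (all other steps of the two reductions being the same), then for at least one $k\in\{1,2\}$ we have $Q_k\vdash^m\Delta$ for some $m<n$ and some $\Delta\leqslant\Gamma$. -/

import Mathlib

namespace CaP

/-! ## Session types -/

/-- Polarity: `out` for outputs (`!`), `inp` for inputs (`?`). -/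
inductive Pol
  | out
  | inp

/-- The opposite polarity. -/
def Pol.flip : Pol → Pol
  | .out => .inp
  | .inp => .out

/-- Node labels of session types.  `unit` is `1` (out) or `⊥` (inp); `branch` is `⊕` (out) or
`&` (inp), with a finite nonempty set of tags each annotated with a measure; `pair` is `⊗` (out)
or `⅋` (inp). -/
inductive Node (Tag : Type)
  | unit (p : Pol)
  | branch (p : Pol) (I : Finset Tag) (hI : I.Nonempty) (ann : {a // a ∈ I} → ℕ)
  | pair (p : Pol)

/-- The polarity of a node. -/
def Node.pol {Tag : Type} : Node Tag → Pol
  | .unit p => p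
  | .branch p _ _ _ => p
  | .pair p => p

/-- The children of a node.  For a pair, `false` is the exchanged channel and `true` the
continuation. -/
abbrev Node.Child {Tag : Type} : Node Tag → Type
  | .unit _ => Empty
  | .branch _ I _ _ => {a // a ∈ I}
  | .pair _ => Bool

/-- The signature of session types. -/
abbrev sig (Tag : Type) : PFunctor := ⟨Node Tag, Node.Child⟩

/-- Finite and infinite trees over the signature of session types (the final coalgebra, so that
equality of trees is bisimilarity). -/
abbrev STree (Tag : Type) : Type := PFunctor.M (sig Tag)

namespace STree

variable {Tag : Type}

/-- `1` (out) and `⊥` (inp). -/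
def unit (p : Pol) : STree Tag := PFunctor.M.mk ⟨Node.unit p, Empty.elim⟩

/-- `⊕{a : f a}` (out) and `&{a : f a}` (inp), where the tag `a` has annotation `ann a`. -/
def branch (p : Pol) (I : Finset Tag) (hI : I.Nonempty) (ann : {a // a ∈ I} → ℕ)
    (f : {a // a ∈ I} → STree Tag) : STree Tag :=
  PFunctor.M.mk ⟨Node.branch p I hI ann, f⟩

/-- `S ⊗ T` (out) and `S ⅋ T` (inp). -/
def pair (p : Pol) (S T : STree Tag) : STree Tag :=
  PFunctor.M.mk ⟨Node.pair p, fun b : Bool => match b with | false => S | true => T⟩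

/-- Polarity of the root. -/
def pol (S : STree Tag) : Pol := Node.pol (PFunctor.M.dest S).1

/-- A tree is positive if its root is `1`, `⊕` or `⊗`. -/
def Pos (S : STree Tag) : Prop := S.pol = Pol.out

/-- The swap of the polarity of the root, children being unchanged. -/
def dualStep (S : STree Tag) : sig Tag (STree Tag) :=
  match PFunctor.M.dest S with
  | ⟨.unit p, f⟩ => ⟨Node.unit p.flip, f⟩
  | ⟨.branch p I hI ann, f⟩ => ⟨Node.branch p.flip I hI ann, f⟩
  | ⟨.pair p, f⟩ => ⟨Node.pair p.flip, f⟩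

/-- The dual of a tree: all polarities are swapped. -/
def dual : STree Tag → STree Tag := PFunctor.M.corec dualStep

/-- `Subtree S T`: the tree `T` is a subtree of `S`. -/
inductive Subtree : STree Tag → STree Tag → Prop
  | refl (S : STree Tag) : Subtree S S
  | child (S : STree Tag) (i : Node.Child (PFunctor.M.dest S).1) {T : STree Tag} :
      Subtree ((PFunctor.M.dest S).2 i) T → Subtree S T

/-- A tree is regular if it has finitely many distinct subtrees. -/
def Regular (S : STree Tag) : Prop := {T | Subtree S T}.Finite

theorem dual_unit (p : Pol) : dual (unit p : STree Tag) = unit p.flip := by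
  rw [← PFunctor.M.mk_dest (dual (unit p : STree Tag))]
  unfold dual
  rw [PFunctor.M.dest_corec]
  simp only [dualStep, unit]
  congr 1
  refine Sigma.ext rfl (heq_of_eq (funext fun i => ?_))
  exact i.elim

theorem dual_branch (p : Pol) (I : Finset Tag) (hI : I.Nonempty) (ann : {a // a ∈ I} → ℕ)
    (f : {a // a ∈ I} → STree Tag) :
    dual (branch p I hI ann f) = branch p.flip I hI ann (fun i => dual (f i)) := by
  rw [← PFunctor.M.mk_dest (dual (branch p I hI ann f))]
  unfold dual
  rw [PFunctor.M.dest_corec]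
  simp only [dualStep, branch]
  rfl

theorem dual_pair (p : Pol) (S T : STree Tag) :
    dual (pair p S T) = pair p.flip (dual S) (dual T) := by
  rw [← PFunctor.M.mk_dest (dual (pair p S T))]
  unfold dual
  rw [PFunctor.M.dest_corec]
  simp only [dualStep, pair]
  congr 1
  refine Sigma.ext rfl (heq_of_eq (funext fun i => ?_))
  cases i <;> rfl

theorem eq_cases (S : STree Tag) :
    (∃ p, S = unit p) ∨ (∃ p I hI ann f, S = branch p I hI ann f) ∨ (∃ p T U, S = pair p T U) := by
  rw [← PFunctor.M.mk_dest S]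
  obtain ⟨a, f⟩ := PFunctor.M.dest S
  cases a with
  | unit p =>
    refine Or.inl ⟨p, ?_⟩
    unfold unit
    congr 1
    exact Sigma.ext rfl (heq_of_eq (funext fun i => i.elim))
  | branch p I hI ann => exact Or.inr (Or.inl ⟨p, I, hI, ann, f, rfl⟩)
  | pair p =>
    refine Or.inr (Or.inr ⟨p, f false, f true, ?_⟩)
    unfold pair
    congr 1
    exact Sigma.ext rfl (heq_of_eq (funext fun i => by cases i <;> rfl))

theorem subtree_mk {x : sig Tag (STree Tag)} {T : STree Tag} (h : Subtree (PFunctor.M.mk x) T) :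
    T = PFunctor.M.mk x ∨ ∃ i, Subtree (x.2 i) T := by
  have key : ∀ S, Subtree S T → ∀ y, PFunctor.M.dest S = y → T = S ∨ ∃ i, Subtree (y.2 i) T := by
    intro S hS y hy
    subst hy
    cases hS with
    | refl => exact Or.inl rfl
    | child S i hi => exact Or.inr ⟨i, hi⟩
  exact key _ h _ (PFunctor.M.dest_mk x)

theorem regular_mk (x : sig Tag (STree Tag)) (hx : Finite (Node.Child x.1))
    (h : ∀ i, Regular (x.2 i)) : Regular (PFunctor.M.mk x) := by
  have : Finite ((sig Tag).B x.1) := hx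
  refine ((Set.finite_singleton (PFunctor.M.mk x)).union (Set.finite_iUnion h)).subset ?_
  intro T hT
  rcases subtree_mk hT with h | ⟨i, hi⟩
  · exact Or.inl h
  · exact Or.inr (Set.mem_iUnion.2 ⟨i, hi⟩)

theorem regular_unit (p : Pol) : Regular (unit p : STree Tag) :=
  regular_mk ⟨Node.unit p, Empty.elim⟩ (inferInstanceAs (Finite Empty)) (fun i => i.elim)

theorem regular_branch (p : Pol) (I : Finset Tag) (hI : I.Nonempty) (ann : {a // a ∈ I} → ℕ)
    (f : {a // a ∈ I} → STree Tag) (h : ∀ i, Regular (f i)) : Regular (branch p I hI ann f) :=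
  regular_mk ⟨Node.branch p I hI ann, f⟩ (inferInstanceAs (Finite {a // a ∈ I})) h

theorem regular_pair (p : Pol) (S T : STree Tag) (hS : Regular S) (hT : Regular T) :
    Regular (pair p S T) := by
  refine regular_mk ⟨Node.pair p, fun b : Bool => match b with | false => S | true => T⟩
    (inferInstanceAs (Finite Bool)) ?_
  intro i
  cases i
  · exact hS
  · exact hT

theorem subtree_dual {S T : STree Tag} (h : Subtree (dual S) T) :
    ∃ U, Subtree S U ∧ T = dual U := by
  have child : ∀ (S : STree Tag) (y : sig Tag (STree Tag)),
      y = (sig Tag).map dual (dualStep S) → ∀ i : Node.Child y.1,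
      ∃ j : Node.Child (PFunctor.M.dest S).1, y.2 i = dual ((PFunctor.M.dest S).2 j) := by
    intro S y hy
    subst hy
    unfold dualStep
    rcases PFunctor.M.dest S with ⟨_ | _ | _, f⟩
    · exact fun i => ⟨i, rfl⟩
    · exact fun i => ⟨i, rfl⟩
    · exact fun i => ⟨i, rfl⟩
  have key : ∀ V U : STree Tag, Subtree V U → ∀ S, V = dual S → ∃ W, Subtree S W ∧ U = dual W := by
    intro V U hV
    induction hV with
    | refl V => intro S hS; exact ⟨S, Subtree.refl S, hS⟩
    | child V i _ ih =>
      intro S hS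
      obtain ⟨j, hj⟩ := child S (PFunctor.M.dest V)
        (by rw [hS]; unfold dual; rw [PFunctor.M.dest_corec]) i
      obtain ⟨W, hW, rfl⟩ := ih _ hj
      exact ⟨W, Subtree.child S j hW, rfl⟩
  exact key _ _ h _ rfl

theorem regular_dual {S : STree Tag} (h : Regular S) : Regular (dual S) := by
  refine (Set.Finite.image dual h).subset ?_
  intro T hT
  obtain ⟨U, hU, rfl⟩ := subtree_dual hT
  exact ⟨U, hU, rfl⟩

end STree

/-- Session types: regular trees. -/
def SType (Tag : Type) : Type := {S : STree Tag // S.Regular}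

namespace SType

variable {Tag : Type}

/-- `1` (out) and `⊥` (inp). -/
def unit (p : Pol) : SType Tag := ⟨STree.unit p, STree.regular_unit p⟩

/-- `⊕` (out) and `&` (inp). -/
def branch (p : Pol) (I : Finset Tag) (hI : I.Nonempty) (ann : {a // a ∈ I} → ℕ)
    (f : {a // a ∈ I} → SType Tag) : SType Tag :=
  ⟨STree.branch p I hI ann (fun i => (f i).1), STree.regular_branch p I hI ann _ (fun i => (f i).2)⟩

/-- `⊗` (out) and `⅋` (inp). -/
def pair (p : Pol) (S T : SType Tag) : SType Tag :=
  ⟨STree.pair p S.1 T.1, STree.regular_pair p S.1 T.1 S.2 T.2⟩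

/-- Duality of session types. -/
def dual (S : SType Tag) : SType Tag := ⟨S.1.dual, STree.regular_dual S.2⟩

end SType

/-! ## Fair asynchronous transitions of session types -/

/-- The content of a label: the termination signal `*`, an annotated tag, or a channel. -/
inductive Msg (Tag : Type)
  | star
  | tag (m : ℕ) (a : Tag)
  | chan (S : STree Tag)

/-- One application of a transition rule for the label `!σ` (`p = out`) or `?σ` (`p = inp`), the
premises being taken from `R`.  The first three constructors are the immediate transitions; the
last two are the late inputs (below `⊕`, `⊗`) and the early outputs (below `&`, `⅋`). -/
inductive TransStep {Tag : Type} (R : STree Tag → STree Tag → Prop) (p : Pol) :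
    Msg Tag → STree Tag → STree Tag → Prop
  | mustUnit : TransStep R p Msg.star (STree.unit p) (STree.unit p)
  | mustBranch (I : Finset Tag) (hI : I.Nonempty) (ann : {a // a ∈ I} → ℕ)
      (f : {a // a ∈ I} → STree Tag) (k : {a // a ∈ I}) :
      TransStep R p (Msg.tag (ann k) k.1) (STree.branch p I hI ann f) (f k)
  | mustPair (S T : STree Tag) : TransStep R p (Msg.chan S) (STree.pair p S T) T
  | mayBranch (σ : Msg Tag) (I : Finset Tag) (hI : I.Nonempty) (ann : {a // a ∈ I} → ℕ)
      (f g : {a // a ∈ I} → STree Tag) : (∀ i, R (f i) (g i)) →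
      TransStep R p σ (STree.branch p.flip I hI ann f) (STree.branch p.flip I hI ann g)
  | mayPair (σ : Msg Tag) (S T T' : STree Tag) : R T T' →
      TransStep R p σ (STree.pair p.flip S T) (STree.pair p.flip S T')

/-- The inductive relation generated by the transition rules together with the corule
`fairBranch`, which follows a single branch. -/
inductive IndTrans {Tag : Type} (p : Pol) : Msg Tag → STree Tag → STree Tag → Prop
  | mustUnit : IndTrans p Msg.star (STree.unit p) (STree.unit p)
  | mustBranch (I : Finset Tag) (hI : I.Nonempty) (ann : {a // a ∈ I} → ℕ)
      (f : {a // a ∈ I} → STree Tag) (k : {a // a ∈ I}) :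
      IndTrans p (Msg.tag (ann k) k.1) (STree.branch p I hI ann f) (f k)
  | mustPair (S T : STree Tag) : IndTrans p (Msg.chan S) (STree.pair p S T) T
  | mayBranch (σ : Msg Tag) (I : Finset Tag) (hI : I.Nonempty) (ann : {a // a ∈ I} → ℕ)
      (f g : {a // a ∈ I} → STree Tag) : (∀ i, IndTrans p σ (f i) (g i)) →
      IndTrans p σ (STree.branch p.flip I hI ann f) (STree.branch p.flip I hI ann g)
  | mayPair (σ : Msg Tag) (S T T' : STree Tag) : IndTrans p σ T T' →
      IndTrans p σ (STree.pair p.flip S T) (STree.pair p.flip S T')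
  | fairBranch (σ : Msg Tag) (I : Finset Tag) (hI : I.Nonempty) (ann : {a // a ∈ I} → ℕ)
      (f g : {a // a ∈ I} → STree Tag) (k : {a // a ∈ I}) : IndTrans p σ (f k) (g k) →
      IndTrans p σ (STree.branch p.flip I hI ann f) (STree.branch p.flip I hI ann g)

/-- The fair asynchronous transition relation, by bounded coinduction: `S` goes to `T` if there is
a possibly infinite derivation with the transition rules in which every judgment has a finite
derivation with rules and corules. -/
def Trans {Tag : Type} (p : Pol) (σ : Msg Tag) (S T : STree Tag) : Prop :=
  ∃ R : STree Tag → STree Tag → Prop,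
    (∀ S T, R S T → TransStep R p σ S T ∧ IndTrans p σ S T) ∧ R S T

/-! ## Correct asynchronous composition and subtyping -/

/-- A relation between session types is a correct asynchronous composition. -/
structure IsCorrect {Tag : Type} (R : STree Tag → STree Tag → Prop) : Prop where
  pos : ∀ S T, R S T → S.Pos ∨ T.Pos
  outStarL : ∀ S T, R S T → ∀ S', Trans Pol.out Msg.star S S' →
    ∃ T', Trans Pol.inp Msg.star T T' ∧ R S' T'
  outStarR : ∀ S T, R S T → ∀ T', Trans Pol.out Msg.star T T' →
    ∃ S', Trans Pol.inp Msg.star S S' ∧ R S' T'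
  outTagL : ∀ S T, R S T → ∀ m a S', Trans Pol.out (Msg.tag m a) S S' →
    ∃ T', Trans Pol.inp (Msg.tag m a) T T' ∧ R S' T'
  outTagR : ∀ S T, R S T → ∀ m a T', Trans Pol.out (Msg.tag m a) T T' →
    ∃ S', Trans Pol.inp (Msg.tag m a) S S' ∧ R S' T'
  outChanL : ∀ S T, R S T → ∀ S₁ S₂, Trans Pol.out (Msg.chan S₁) S S₂ →
    ∃ T₁ T₂, Trans Pol.inp (Msg.chan T₁) T T₂ ∧ R S₁ T₁ ∧ R S₂ T₂
  outChanR : ∀ S T, R S T → ∀ T₁ T₂, Trans Pol.out (Msg.chan T₁) T T₂ →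
    ∃ S₁ S₂, Trans Pol.inp (Msg.chan S₁) S S₂ ∧ R S₁ T₁ ∧ R S₂ T₂

/-- `S` and `T` compose correctly. -/
def Correct {Tag : Type} (S T : SType Tag) : Prop :=
  ∃ R : STree Tag → STree Tag → Prop, IsCorrect R ∧ R S.1 T.1

/-- Fair asynchronous subtyping `S ≤ T`: every session type that composes correctly with `T` also
composes correctly with `S`. -/
def Sub {Tag : Type} (S T : SType Tag) : Prop := ∀ R : SType Tag, Correct R T → Correct R S

/-! ## Processes -/

/-- Processes, up to renaming of bound channels: channels are de Bruijn indices, and an index that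
exceeds the number of enclosing binders is a free channel.  `Name` is the set of process names. -/
inductive Proc (Tag Name : Type)
  /-- link between `x` and `y` -/
  | link (x y : ℕ)
  /-- signal output -/
  | close (x : ℕ)
  /-- tag output -/
  | select (x : ℕ) (a : Tag) (P : Proc Tag Name)
  /-- channel output: sends a fresh channel, which is the index `0` of `P` and is not in scope
  in `Q`, on `x` -/
  | fork (x : ℕ) (P Q : Proc Tag Name)
  /-- choice -/
  | choice (P Q : Proc Tag Name)
  /-- termination -/
  | done
  /-- invocation -/
  | call (A : Name) (xs : List ℕ)
  /-- signal input -/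
  | wait (x : ℕ) (P : Proc Tag Name)
  /-- tag input -/
  | case (x : ℕ) (I : Finset Tag) (P : {a // a ∈ I} → Proc Tag Name)
  /-- channel input: the received channel is the index `0` of `P` -/
  | join (x : ℕ) (P : Proc Tag Name)
  /-- composition: the new channel is the index `0` of both `P` and `Q` -/
  | cut (P Q : Proc Tag Name)

/-- The extension of a renaming under a binder. -/
def lift (ρ : ℕ → ℕ) : ℕ → ℕ
  | 0 => 0
  | i + 1 => ρ i + 1

/-- The exchange of the two innermost binders. -/
def swap : ℕ → ℕ
  | 0 => 1
  | 1 => 0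
  | i + 2 => i + 2

/-- The renaming that removes the innermost binder by replacing its channel with `y`. -/
def inst (y : ℕ) : ℕ → ℕ
  | 0 => y
  | i + 1 => i

namespace Proc

variable {Tag Name : Type}

/-- Renaming of free channels. -/
def ren : (ℕ → ℕ) → Proc Tag Name → Proc Tag Name
  | ρ, link x y => link (ρ x) (ρ y)
  | ρ, close x => close (ρ x)
  | ρ, select x a P => select (ρ x) a (ren ρ P)
  | ρ, fork x P Q => fork (ρ x) (ren (lift ρ) P) (ren ρ Q)
  | ρ, choice P Q => choice (ren ρ P) (ren ρ Q)
  | _, done => done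
  | ρ, call A xs => call A (xs.map ρ)
  | ρ, wait x P => wait (ρ x) (ren ρ P)
  | ρ, case x I P => case (ρ x) I (fun a => ren ρ (P a))
  | ρ, join x P => join (ρ x) (ren (lift ρ) P)
  | ρ, cut P Q => cut (ren (lift ρ) P) (ren (lift ρ) Q)

/-- Free channels. -/
def fn : Proc Tag Name → Set ℕ
  | link x y => {x, y}
  | close x => {x}
  | select x _ P => {x} ∪ fn P
  | fork x P Q => {x} ∪ {i | i + 1 ∈ fn P} ∪ fn Q
  | choice P Q => fn P ∪ fn Q
  | done => ∅
  | call _ xs => {i | i ∈ xs}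
  | wait x P => {x} ∪ fn P
  | case x _ P => {x} ∪ {i | ∃ a, i ∈ fn (P a)}
  | join x P => {x} ∪ {i | i + 1 ∈ fn P}
  | cut P Q => {i | i + 1 ∈ fn P} ∪ {i | i + 1 ∈ fn Q}

/-- All invocations are guarded by a prefix or by a choice. -/
def Guarded : Proc Tag Name → Prop
  | call _ _ => False
  | cut P Q => Guarded P ∧ Guarded Q
  | _ => True

end Proc

/-- Global definitions.  The process name `A` is defined by `A(0, …, arity A - 1) = body A`. -/
structure Program (Tag Name : Type) where
  arity : Name → ℕ
  body : Name → Proc Tag Name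
  fn_body : ∀ A, (body A).fn = {i | i < arity A}
  guarded : ∀ A, (body A).Guarded

/-- The body of `A` where the parameters are replaced by `xs`. -/
def Program.unfold {Tag Name : Type} (D : Program Tag Name) (A : Name) (xs : List ℕ) :
    Proc Tag Name :=
  (D.body A).ren (fun i => xs.getD i 0)

/-- Buffers.  The channel of the buffer is only given when the hole is filled, by `Buf.plug`. -/
inductive Buf (Tag Name : Type)
  | hole
  | select (a : Tag) (B : Buf Tag Name)
  /-- as in `Proc.fork`, the index `0` of `P` is the channel that is sent -/
  | fork (P : Proc Tag Name) (B : Buf Tag Name)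

namespace Buf

variable {Tag Name : Type}

/-- `B.plug x P` is `B` as a buffer of messages sent on `x`, with `P` in the hole. -/
def plug : Buf Tag Name → ℕ → Proc Tag Name → Proc Tag Name
  | hole, _, P => P
  | select a B, x, P => Proc.select x a (plug B x P)
  | fork R B, x, P => Proc.fork x R (plug B x P)

/-- Renaming of the free channels of the processes in a buffer. -/
def ren (ρ : ℕ → ℕ) : Buf Tag Name → Buf Tag Name
  | hole => hole
  | select a B => select a (ren ρ B)
  | fork R B => fork (R.ren (lift ρ)) (ren ρ B)

/-- Free channels of the processes in a buffer (the channel of the buffer is not counted). -/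
def fn : Buf Tag Name → Set ℕ
  | hole => ∅
  | select _ B => fn B
  | fork R B => {i | i + 1 ∈ R.fn} ∪ fn B

end Buf

/-! ## Operational semantics -/

open Proc in
/-- Structural pre-congruence.  A process or buffer that does not contain the channel `0` of the
enclosing binder is written `Q.ren (· + 1)`.  When a cut is moved below a binder, its other
processes are renamed with `lift (· + 1)` and the two binders are exchanged with `swap`. -/
inductive PreCong {Tag Name : Type} (D : Program Tag Name) :
    Proc Tag Name → Proc Tag Name → Prop
  | refl (P) : PreCong D P P
  | trans {P Q R} : PreCong D P Q → PreCong D Q R → PreCong D P R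
  | cut {P P' Q Q'} : PreCong D P P' → PreCong D Q Q' → PreCong D (cut P Q) (cut P' Q')
  | buffer {P P'} (B : Buf Tag Name) (x : ℕ) : PreCong D P P' →
      PreCong D (B.plug x P) (B.plug x P')
  | sCall (A xs) : xs.length = D.arity A → PreCong D (call A xs) (D.unfold A xs)
  | sLink (x y) : PreCong D (link x y) (link y x)
  | sComm (P Q) : PreCong D (cut P Q) (cut Q P)
  | sWait (B : Buf Tag Name) (y P Q) :
      PreCong D (cut (B.plug 0 (wait (y + 1) P)) Q) (wait y (cut (B.plug 0 P) Q))
  | sCase (B : Buf Tag Name) (y I P Q) :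
      PreCong D (cut (B.plug 0 (case (y + 1) I P)) Q)
        (case y I (fun a => cut (B.plug 0 (P a)) Q))
  | sJoin (B : Buf Tag Name) (y P Q) :
      PreCong D (cut (B.plug 0 (join (y + 1) P)) Q)
        (join y (cut ((B.ren (lift (· + 1))).plug 0 (P.ren swap)) (Q.ren (lift (· + 1)))))
  | sPull0 (B B' : Buf Tag Name) (y P) :
      PreCong D (cut (B.plug 0 P) (B'.plug 0 (link 0 (y + 1))))
        ((B.ren (inst y)).plug y (cut P (B'.plug 0 (link 0 (y + 1)))))
  | sPull1 (y P Q R) : 1 ∈ P.fn →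
      PreCong D (cut (fork (y + 1) P (Q.ren (· + 1))) R)
        (fork y (cut (P.ren swap) (R.ren (lift (· + 1)))) Q)
  | sPull2 (B : Buf Tag Name) (y P Q) :
      PreCong D (cut ((B.ren (· + 1)).plug (y + 1) P) Q) (B.plug y (cut P Q))
  | sPull3 (B : Buf Tag Name) (x y P Q) : x ≠ y → x + 1 ∈ P.fn → x ∉ Q.fn →
      PreCong D (B.plug x (fork y P Q)) (fork y ((B.ren (· + 1)).plug (x + 1) P) Q)
  | sPull4 (B B' : Buf Tag Name) (x y P) : x ≠ y → x ∈ P.fn → x ∉ B'.fn →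
      PreCong D (B.plug x (B'.plug y P)) (B'.plug y (B.plug x P))

open Proc in
/-- The base reductions other than the resolution of a choice. -/
inductive BaseComm {Tag Name : Type} : Proc Tag Name → Proc Tag Name → Prop
  | rLink (y P) : BaseComm (cut (link 0 (y + 1)) P) (P.ren (inst y))
  | rClose (P) : BaseComm (cut (close 0) (wait 0 (P.ren (· + 1)))) P
  | rSelect (B : Buf Tag Name) (a : Tag) (P I) (Q : {a // a ∈ I} → Proc Tag Name) (ha : a ∈ I) :
      BaseComm (cut (select 0 a P) (B.plug 0 (case 0 I Q))) (cut P (B.plug 0 (Q ⟨a, ha⟩)))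
  | rFork (B : Buf Tag Name) (P Q R) :
      BaseComm (cut (fork 0 (P.ren (lift (· + 1))) Q) (B.plug 0 (join 0 R)))
        (cut P (cut (Q.ren (lift (· + 1))) ((B.ren (lift (· + 1))).plug 0 (R.ren swap))))

open Proc in
/-- Reduction. -/
inductive Red {Tag Name : Type} (D : Program Tag Name) : Proc Tag Name → Proc Tag Name → Prop
  | rChoiceL (P Q) : Red D (choice P Q) P
  | rChoiceR (P Q) : Red D (choice P Q) Q
  | base {P Q} : BaseComm P Q → Red D P Q
  | rCut {P Q} (R) : Red D P Q → Red D (cut P R) (cut Q R)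
  | rBuffer {P Q} (B : Buf Tag Name) (x : ℕ) : Red D P Q → Red D (B.plug x P) (B.plug x Q)
  | rStr {P R Q} : PreCong D P R → Red D R Q → Red D P Q

open Proc in
/-- Reduction whose base reduction is not the resolution of a choice. -/
inductive CommRed {Tag Name : Type} (D : Program Tag Name) :
    Proc Tag Name → Proc Tag Name → Prop
  | base {P Q} : BaseComm P Q → CommRed D P Q
  | rCut {P Q} (R) : CommRed D P Q → CommRed D (cut P R) (cut Q R)
  | rBuffer {P Q} (B : Buf Tag Name) (x : ℕ) : CommRed D P Q →
      CommRed D (B.plug x P) (B.plug x Q)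
  | rStr {P R Q} : PreCong D P R → CommRed D R Q → CommRed D P Q

open Proc in
/-- `ChoiceRed D P Q₁ Q₂`: the processes `Q₁` and `Q₂` are obtained from `P` by resolving one and
the same choice to the left and to the right, respectively. -/
inductive ChoiceRed {Tag Name : Type} (D : Program Tag Name) :
    Proc Tag Name → Proc Tag Name → Proc Tag Name → Prop
  | rChoice (P Q) : ChoiceRed D (choice P Q) P Q
  | rCut {P Q₁ Q₂} (R) : ChoiceRed D P Q₁ Q₂ → ChoiceRed D (cut P R) (cut Q₁ R) (cut Q₂ R)
  | rBuffer {P Q₁ Q₂} (B : Buf Tag Name) (x : ℕ) : ChoiceRed D P Q₁ Q₂ →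
      ChoiceRed D (B.plug x P) (B.plug x Q₁) (B.plug x Q₂)
  | rStr {P R Q₁ Q₂} : PreCong D P R → ChoiceRed D R Q₁ Q₂ → ChoiceRed D P Q₁ Q₂

/-- Every reduction is of one of the two kinds above. -/
theorem red_iff {Tag Name : Type} (D : Program Tag Name) (P Q : Proc Tag Name) :
    Red D P Q ↔ CommRed D P Q ∨ ∃ R, ChoiceRed D P Q R ∨ ChoiceRed D P R Q := by
  constructor
  · intro h
    induction h with
    | rChoiceL P Q => exact Or.inr ⟨Q, Or.inl (.rChoice P Q)⟩
    | rChoiceR P Q => exact Or.inr ⟨P, Or.inr (.rChoice P Q)⟩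
    | base h => exact Or.inl (.base h)
    | rCut R _ ih =>
      rcases ih with h | ⟨S, h | h⟩
      · exact Or.inl (.rCut R h)
      · exact Or.inr ⟨_, Or.inl (.rCut R h)⟩
      · exact Or.inr ⟨_, Or.inr (.rCut R h)⟩
    | rBuffer B x _ ih =>
      rcases ih with h | ⟨S, h | h⟩
      · exact Or.inl (.rBuffer B x h)
      · exact Or.inr ⟨_, Or.inl (.rBuffer B x h)⟩
      · exact Or.inr ⟨_, Or.inr (.rBuffer B x h)⟩
    | rStr hp _ ih =>
      rcases ih with h | ⟨S, h | h⟩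
      · exact Or.inl (.rStr hp h)
      · exact Or.inr ⟨_, Or.inl (.rStr hp h)⟩
      · exact Or.inr ⟨_, Or.inr (.rStr hp h)⟩
  · have key : ∀ P Q₁ Q₂, ChoiceRed D P Q₁ Q₂ → Red D P Q₁ ∧ Red D P Q₂ := by
      intro P Q₁ Q₂ h
      induction h with
      | rChoice P Q => exact ⟨.rChoiceL P Q, .rChoiceR P Q⟩
      | rCut R _ ih => exact ⟨.rCut R ih.1, .rCut R ih.2⟩
      | rBuffer B x _ ih => exact ⟨.rBuffer B x ih.1, .rBuffer B x ih.2⟩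
      | rStr hp _ ih => exact ⟨.rStr hp ih.1, .rStr hp ih.2⟩
    rintro (h | ⟨R, h | h⟩)
    · induction h with
      | base h => exact .base h
      | rCut R _ ih => exact .rCut R ih
      | rBuffer B x _ ih => exact .rBuffer B x ih
      | rStr hp _ ih => exact .rStr hp ih
    · exact (key _ _ _ h).1
    · exact (key _ _ _ h).2

/-! ## Type system -/

/-- Typing contexts: partial maps from channels to session types. -/
def Ctx (Tag : Type) : Type := ℕ → Option (SType Tag)

namespace Ctx

variable {Tag : Type}

/-- The empty context. -/
def empty : Ctx Tag := fun _ => none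

/-- The context where the association for `x` is replaced by (or removed according to) `o`. -/
def set (Γ : Ctx Tag) (x : ℕ) (o : Option (SType Tag)) : Ctx Tag := Function.update Γ x o

/-- The context below a binder whose channel has type `S`. -/
def cons (S : SType Tag) (Γ : Ctx Tag) : Ctx Tag
  | 0 => some S
  | i + 1 => Γ i

/-- `Γ` is the union of `Γ₁` and `Γ₂`, whose domains are disjoint. -/
def Split (Γ Γ₁ Γ₂ : Ctx Tag) : Prop :=
  ∀ x, (Γ₁ x = Γ x ∧ Γ₂ x = none) ∨ (Γ₁ x = none ∧ Γ₂ x = Γ x)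

/-- `Δ ≤ Γ`: same domain, and pointwise fair asynchronous subtyping. -/
def Le (Δ Γ : Ctx Tag) : Prop := ∀ x, Option.Rel Sub (Δ x) (Γ x)

end Ctx

/-- One application of a typing rule, the premises being taken from `R`. -/
inductive TypeStep {Tag Name : Type} (D : Program Tag Name)
    (R : ℕ → Ctx Tag → Proc Tag Name → Prop) : ℕ → Ctx Tag → Proc Tag Name → Prop
  | done (Γ : Ctx Tag) : Γ = Ctx.empty → TypeStep D R 0 Γ Proc.done
  | call (m n Γ A xs) : xs.length = D.arity A → xs.Nodup → (∀ x, Γ x ≠ none ↔ x ∈ xs) →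
      R n Γ (D.unfold A xs) → TypeStep D R (m + n) Γ (Proc.call A xs)
  | link (x y S T) (Γ : Ctx Tag) : x ≠ y → Γ = (Ctx.empty.set x (some S)).set y (some T) →
      Sub (SType.dual S) T → TypeStep D R 1 Γ (Proc.link x y)
  | cut (m n Γ Γ₁ Γ₂ S T P Q) : Ctx.Split Γ Γ₁ Γ₂ → Correct S T →
      R m (Ctx.cons S Γ₁) P → R n (Ctx.cons T Γ₂) Q → TypeStep D R (m + n) Γ (Proc.cut P Q)
  | choiceL (m n Γ P Q) : R m Γ P → R n Γ Q → TypeStep D R (1 + m) Γ (Proc.choice P Q)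
  | choiceR (m n Γ P Q) : R m Γ P → R n Γ Q → TypeStep D R (1 + n) Γ (Proc.choice P Q)
  | one (x) (Γ : Ctx Tag) : Γ = Ctx.empty.set x (some (SType.unit Pol.out)) →
      TypeStep D R 1 Γ (Proc.close x)
  | bot (n x P) (Γ : Ctx Tag) : Γ x = some (SType.unit Pol.inp) → R n (Γ.set x none) P →
      TypeStep D R n Γ (Proc.wait x P)
  | plus (n x P) (Γ : Ctx Tag) (I hI ann) (S : {a // a ∈ I} → SType Tag) (k : {a // a ∈ I}) :
      Γ x = some (SType.branch Pol.out I hI ann S) → R n (Γ.set x (some (S k))) P →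
      TypeStep D R (1 + ann k + n) Γ (Proc.select x k.1 P)
  /-- the process may have more branches than the type -/
  | amp (n x I J) (hJI : J ⊆ I) (P : {a // a ∈ I} → Proc Tag Name) (Γ : Ctx Tag) (hJ ann)
      (S : {a // a ∈ J} → SType Tag) :
      Γ x = some (SType.branch Pol.inp J hJ ann S) →
      (∀ j : {a // a ∈ J}, R (n + ann j) (Γ.set x (some (S j))) (P ⟨j.1, hJI j.2⟩)) →
      TypeStep D R n Γ (Proc.case x I P)
  | tensor (m n x P Q) (Γ Γ₁ Γ₂ : Ctx Tag) (S T) : Γ x = some (SType.pair Pol.out S T) →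
      Ctx.Split (Γ.set x none) Γ₁ Γ₂ → R m (Ctx.cons S Γ₁) P → R n (Γ₂.set x (some T)) Q →
      TypeStep D R (1 + m + n) Γ (Proc.fork x P Q)
  | par (n x P) (Γ : Ctx Tag) (S T) : Γ x = some (SType.pair Pol.inp S T) →
      R n (Ctx.cons S (Γ.set x (some T))) P → TypeStep D R n Γ (Proc.join x P)

/-- `P` is well typed in `Γ` with measure `n`: the typing rules are interpreted coinductively. -/
def Typed {Tag Name : Type} (D : Program Tag Name) (n : ℕ) (Γ : Ctx Tag) (P : Proc Tag Name) :
    Prop :=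
  ∃ R : ℕ → Ctx Tag → Proc Tag Name → Prop,
    (∀ n Γ P, R n Γ P → TypeStep D R n Γ P) ∧ R n Γ P

end CaP

namespace CaP

/-! Most rules of the pre-congruence and most reductions only rearrange a typing derivation: context
splits are reassociated and sums of measures are regrouped. Two phenomena go beyond bookkeeping,
both caused by asynchrony.

The first is that a receiver may consume a message although its own earlier outputs still sit in a
buffer in front of the input. `BufTyped` records how a buffer transforms the type of its channel,
and `BufTyped.late` shows that an input transition of the type in front of the buffer passes through
to the type behind it. In a communication, correct composition answers the output of the sender by
an input of the receiver's type, possibly late; carried through the buffer, it becomes an immediate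
input of the exposed prefix. The annotation of a tag is charged to the sender and granted to the
branch of the receiver, so the total measure drops by exactly the 1 paid for the output.

The second is that types shrink. A link is typed up to subtyping, so eliminating it or moving a
buffer across it changes the type of the surviving channel. Two facts about subtyping are needed.
`Correct.sub_dual` reads S ⋈ T as T ≤ Sᗮ; it rests on `STree.Correct.cut`, which composes through a
dual intermediate type. `Sub.select` and `Sub.pair` say that an output that S can perform, even
early, may be hoisted to the root; they rest on `STree.Correct.prefix_right`, a coinduction whose
engine is the commutation `Trans.diamond`. `BufTyped.drain` combines them to carry all messages of a
buffer to the other end of a link, and `Typed.plug_replace` uses them to propagate a smaller context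
outwards through a buffer.

Subtyping quantifies over regular types only, so residuals and exchanged types must be regular: this
is `Trans.regular` and `Trans.subtree_chan`. The latter depends on fairness, that is, on the finite
derivations.

The theorem then follows by induction on reductions, since pre-congruence never increases the
measure. For a choice both reducts are typed at once, and the typing rule designates the one whose
measure is smaller. -/

@[simp]
theorem Pol.flip_flip (p : Pol) : p.flip.flip = p := by cases p <;> rfl

theorem Pol.flip_ne (p : Pol) : p.flip ≠ p := by cases p <;> nofun

/-! ### Constructors, bisimulation and subtrees of infinite trees -/

namespace STree

variable {Tag : Type}

theorem dest_unit (p : Pol) :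
    PFunctor.M.dest (unit p : STree Tag) = ⟨Node.unit p, Empty.elim⟩ :=
  PFunctor.M.dest_mk _

theorem dest_branch (p : Pol) (I : Finset Tag) (hI ann) (f : {a // a ∈ I} → STree Tag) :
    PFunctor.M.dest (branch p I hI ann f) = ⟨Node.branch p I hI ann, f⟩ :=
  PFunctor.M.dest_mk _

theorem dest_pair (p : Pol) (S T : STree Tag) :
    PFunctor.M.dest (pair p S T) =
      ⟨Node.pair p, fun b : Bool => match b with | false => S | true => T⟩ :=
  PFunctor.M.dest_mk _

theorem unit_inj {p q : Pol} (h : (unit p : STree Tag) = unit q) : p = q := by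
  have h' := congrArg PFunctor.M.dest h
  rw [dest_unit, dest_unit] at h'
  injection h' with h1 _
  injection h1

/-- Annotations and children are families over the tag set, so they can only be compared
heterogeneously until `I = J` has been substituted. -/
theorem branch_inj {p q : Pol} {I J : Finset Tag} {hI : I.Nonempty} {hJ : J.Nonempty}
    {m : {a // a ∈ I} → ℕ} {n : {a // a ∈ J} → ℕ} {f : {a // a ∈ I} → STree Tag}
    {g : {a // a ∈ J} → STree Tag} (h : branch p I hI m f = branch q J hJ n g) :
    p = q ∧ I = J ∧ HEq m n ∧ HEq f g := by
  have h' := congrArg PFunctor.M.dest h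
  rw [dest_branch, dest_branch] at h'
  injection h' with h1 h2
  injection h1 with h3 h4 h5
  exact ⟨h3, h4, h5, h2⟩

theorem pair_inj {p q : Pol} {S T S' T' : STree Tag} (h : pair p S T = pair q S' T') :
    p = q ∧ S = S' ∧ T = T' := by
  have h' := congrArg PFunctor.M.dest h
  rw [dest_pair, dest_pair] at h'
  injection h' with h1 h2
  injection h1 with h3
  subst h3
  exact ⟨rfl, congrFun h2 false, congrFun h2 true⟩

theorem unit_ne_branch {p q : Pol} {I : Finset Tag} {hI : I.Nonempty} {m f} :
    (unit p : STree Tag) ≠ branch q I hI m f := by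
  intro h
  have h' := congrArg PFunctor.M.dest h
  rw [dest_unit, dest_branch] at h'
  injection h' with h1 _
  injection h1

theorem unit_ne_pair {p q : Pol} {S T : STree Tag} : (unit p : STree Tag) ≠ pair q S T := by
  intro h
  have h' := congrArg PFunctor.M.dest h
  rw [dest_unit, dest_pair] at h'
  injection h' with h1 _
  injection h1

theorem branch_ne_pair {p q : Pol} {I : Finset Tag} {hI : I.Nonempty} {m f} {S T : STree Tag} :
    branch q I hI m f ≠ pair p S T := by
  intro h
  have h' := congrArg PFunctor.M.dest h
  rw [dest_branch, dest_pair] at h'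
  injection h' with h1 _
  injection h1

@[simp]
theorem pol_unit (p : Pol) : (unit p : STree Tag).pol = p := by
  rw [pol, dest_unit, Node.pol]

@[simp]
theorem pol_branch (p : Pol) (I : Finset Tag) (hI m f) : (branch p I hI m f).pol = p := by
  rw [pol, dest_branch, Node.pol]

@[simp]
theorem pol_pair (p : Pol) (S T : STree Tag) : (pair p S T).pol = p := by
  rw [pol, dest_pair, Node.pol]

theorem pol_dual (S : STree Tag) : S.dual.pol = S.pol.flip := by
  rcases S.eq_cases with ⟨p, rfl⟩ | ⟨p, I, hI, ann, f, rfl⟩ | ⟨p, T, U, rfl⟩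
  · simp [dual_unit]
  · simp [dual_branch]
  · simp [dual_pair]

/-- Coinduction principle for the equality of trees. -/
theorem eq_of_bisim (R : STree Tag → STree Tag → Prop)
    (h : ∀ S T, R S T → S = T ∨
      (∃ p I hI ann f g, S = branch p I hI ann f ∧ T = branch p I hI ann g ∧
        ∀ i, R (f i) (g i)) ∨
      (∃ p S₁ S₂ T₁ T₂, S = pair p S₁ S₂ ∧ T = pair p T₁ T₂ ∧ (S₁ = T₁ ∨ R S₁ T₁) ∧ R S₂ T₂))
    {S T : STree Tag} (hST : R S T) : S = T := by
  refine PFunctor.M.bisim (fun S T => S = T ∨ R S T) ?_ S T (Or.inr hST)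
  rintro S T hS
  have hS : S = T ∨ _ := hS.elim Or.inl (h S T)
  rcases hS with rfl | ⟨p, I, hI, ann, f, g, rfl, rfl, hfg⟩ | ⟨p, S₁, S₂, T₁, T₂, rfl, rfl, h₁, h₂⟩
  · exact ⟨_, _, _, rfl, rfl, fun _ => Or.inl rfl⟩
  · exact ⟨_, _, _, PFunctor.M.dest_mk _, PFunctor.M.dest_mk _, fun i => Or.inr (hfg i)⟩
  · refine ⟨_, _, _, PFunctor.M.dest_mk _, PFunctor.M.dest_mk _, fun i => ?_⟩
    cases i
    · exact h₁
    · exact Or.inr h₂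

@[simp]
theorem dual_dual (S : STree Tag) : S.dual.dual = S := by
  refine eq_of_bisim (fun S T => S = T.dual.dual) ?_ rfl
  rintro _ T rfl
  rcases T.eq_cases with ⟨p, rfl⟩ | ⟨p, I, hI, ann, f, rfl⟩ | ⟨p, T, U, rfl⟩
  · simp [dual_unit]
  · exact Or.inr (Or.inl ⟨p, I, hI, ann, _, f, by simp [dual_branch], rfl, fun _ => rfl⟩)
  · exact Or.inr (Or.inr ⟨p, _, _, T, U, by simp [dual_pair], rfl, Or.inr rfl, rfl⟩)

theorem Subtree.trans {S T U : STree Tag} (h : Subtree S T) (h' : Subtree T U) : Subtree S U := by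
  induction h with
  | refl => exact h'
  | child S i _ ih => exact .child S i (ih h')

theorem Regular.of_subtree {S T : STree Tag} (hS : S.Regular) (h : Subtree S T) : T.Regular :=
  hS.subset fun _ hU => h.trans hU

theorem subtree_child (x : sig Tag (STree Tag)) (i : Node.Child x.1) :
    Subtree (PFunctor.M.mk x) (x.2 i) := by
  have key : ∀ S : STree Tag, ∀ y : sig Tag (STree Tag), PFunctor.M.dest S = y →
      ∀ i : Node.Child y.1, Subtree S (y.2 i) := by
    intro S y hy
    subst hy
    exact fun i => .child S i (.refl _)
  exact key _ _ (PFunctor.M.dest_mk x) i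

theorem subtree_branch (p : Pol) (I : Finset Tag) (hI ann) (f : {a // a ∈ I} → STree Tag) (i) :
    Subtree (branch p I hI ann f) (f i) :=
  subtree_child ⟨Node.branch p I hI ann, f⟩ i

theorem subtree_pair_left (p : Pol) (S T : STree Tag) : Subtree (pair p S T) S :=
  subtree_child ⟨Node.pair p, fun b : Bool => match b with | false => S | true => T⟩ false

theorem subtree_pair_right (p : Pol) (S T : STree Tag) : Subtree (pair p S T) T :=
  subtree_child ⟨Node.pair p, fun b : Bool => match b with | false => S | true => T⟩ true

/-- Induction on the path to a subtree. -/
theorem Subtree.path_induction {U : STree Tag} {motive : STree Tag → Prop} (refl : motive U)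
    (branch : ∀ p I hI ann f i, Subtree (f i) U → motive (f i) → motive (branch p I hI ann f))
    (pair_left : ∀ p S T, Subtree S U → motive S → motive (pair p S T))
    (pair_right : ∀ p S T, Subtree T U → motive T → motive (pair p S T))
    {S : STree Tag} (h : Subtree S U) : motive S := by
  induction h with
  | refl => exact refl
  | @child S i T hi ih =>
    have key : ∀ y : sig Tag (STree Tag), PFunctor.M.dest S = y → ∀ i : Node.Child y.1,
        Subtree (y.2 i) T → motive (y.2 i) → motive S := by
      intro y hy i hi ih
      rcases S.eq_cases with ⟨p, rfl⟩ | ⟨p, I, hI, ann, f, rfl⟩ | ⟨p, T, U, rfl⟩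
      · rw [dest_unit] at hy
        subst hy
        exact i.elim
      · rw [dest_branch] at hy
        subst hy
        exact branch _ _ _ _ _ i hi ih
      · rw [dest_pair] at hy
        subst hy
        cases i
        · exact pair_left _ _ _ hi ih
        · exact pair_right _ _ _ hi ih
    exact key _ rfl i hi (ih refl branch pair_left pair_right)

end STree

open STree

/-! ### Inversion and introduction of transitions -/

variable {Tag : Type}

theorem TransStep.mono {R R' : STree Tag → STree Tag → Prop} (h : ∀ S T, R S T → R' S T) {p : Pol}
    {σ : Msg Tag} {S T : STree Tag} (hS : TransStep R p σ S T) : TransStep R' p σ S T := by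
  cases hS with
  | mustUnit => exact .mustUnit
  | mustBranch I hI ann f k => exact .mustBranch I hI ann f k
  | mustPair S T => exact .mustPair S T
  | mayBranch _ I hI ann f g hfg => exact .mayBranch σ I hI ann f g fun i => h _ _ (hfg i)
  | mayPair _ S T T' hT => exact .mayPair σ S T T' (h _ _ hT)

theorem Trans.ind {p : Pol} {σ : Msg Tag} {S T : STree Tag} (h : Trans p σ S T) :
    IndTrans p σ S T := by
  obtain ⟨R, hR, hST⟩ := h
  exact (hR _ _ hST).2

theorem Trans.step {p : Pol} {σ : Msg Tag} {S T : STree Tag} (h : Trans p σ S T) :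
    TransStep (Trans p σ) p σ S T := by
  obtain ⟨R, hR, hST⟩ := h
  exact (hR _ _ hST).1.mono fun _ _ h => ⟨R, hR, h⟩

/-- One extra rule application on top of `Trans` is again a legitimate witness: the infinite part
unfolds by `Trans.step`, and the finite derivation of the conclusion is assembled from those of the
premises. -/
theorem TransStep.trans {p : Pol} {σ : Msg Tag} {S T : STree Tag}
    (h : TransStep (Trans p σ) p σ S T) : Trans p σ S T := by
  refine ⟨fun S T => TransStep (Trans p σ) p σ S T, fun S T h => ⟨?_, ?_⟩, h⟩
  · exact h.mono fun _ _ => Trans.step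
  · cases h with
    | mustUnit => exact .mustUnit
    | mustBranch I hI ann f k => exact .mustBranch I hI ann f k
    | mustPair S T => exact .mustPair S T
    | mayBranch _ I hI ann f g hfg => exact .mayBranch σ I hI ann f g fun i => (hfg i).ind
    | mayPair _ S T T' hT => exact .mayPair σ S T T' hT.ind

namespace Trans

variable {p : Pol} {σ : Msg Tag}

theorem mustBranch {I : Finset Tag} {hI ann} {f : {a // a ∈ I} → STree Tag} (k) :
    Trans p (Msg.tag (ann k) k.1) (branch p I hI ann f) (f k) :=
  (TransStep.mustBranch I hI ann f k).trans

theorem mustPair {S T : STree Tag} : Trans p (Msg.chan S) (pair p S T) T :=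
  (TransStep.mustPair S T).trans

theorem mayBranch {I : Finset Tag} {hI ann} {f g : {a // a ∈ I} → STree Tag}
    (h : ∀ i, Trans p σ (f i) (g i)) :
    Trans p σ (branch p.flip I hI ann f) (branch p.flip I hI ann g) :=
  (TransStep.mayBranch σ I hI ann f g h).trans

theorem mayPair {S T T' : STree Tag} (h : Trans p σ T T') :
    Trans p σ (pair p.flip S T) (pair p.flip S T') :=
  (TransStep.mayPair σ S T T' h).trans

theorem unit_inv {q : Pol} {T : STree Tag} (h : Trans p σ (STree.unit q) T) :
    q = p ∧ σ = Msg.star ∧ T = STree.unit q := by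
  have key : ∀ S, Trans p σ S T → S = STree.unit q → q = p ∧ σ = Msg.star ∧ T = STree.unit q := by
    intro S h hS
    cases h.step with
    | mustUnit => exact ⟨(unit_inj hS).symm, rfl, hS⟩
    | mustBranch => exact (unit_ne_branch hS.symm).elim
    | mustPair => exact (unit_ne_pair hS.symm).elim
    | mayBranch => exact (unit_ne_branch hS.symm).elim
    | mayPair => exact (unit_ne_pair hS.symm).elim
  exact key _ h rfl

theorem branch_inv {q : Pol} {I : Finset Tag} {hI ann} {f : {a // a ∈ I} → STree Tag}
    {T : STree Tag} (h : Trans p σ (branch q I hI ann f) T) :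
    (q = p ∧ ∃ k, σ = Msg.tag (ann k) k.1 ∧ T = f k) ∨
    (q = p.flip ∧ ∃ g, T = branch q I hI ann g ∧ ∀ i, Trans p σ (f i) (g i)) := by
  have key : ∀ S, Trans p σ S T → S = branch q I hI ann f →
      (q = p ∧ ∃ k, σ = Msg.tag (ann k) k.1 ∧ T = f k) ∨
      (q = p.flip ∧ ∃ g, T = branch q I hI ann g ∧ ∀ i, Trans p σ (f i) (g i)) := by
    intro S h hS
    cases h.step with
    | mustUnit => exact (unit_ne_branch hS).elim
    | mustBranch I' hI' ann' f' k =>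
      obtain ⟨rfl, rfl, h1, h2⟩ := branch_inj hS
      obtain rfl := eq_of_heq h1
      obtain rfl := eq_of_heq h2
      exact Or.inl ⟨rfl, k, rfl, rfl⟩
    | mustPair => exact (branch_ne_pair hS.symm).elim
    | mayBranch _ I' hI' ann' f' g hfg =>
      obtain ⟨rfl, rfl, h1, h2⟩ := branch_inj hS
      obtain rfl := eq_of_heq h1
      obtain rfl := eq_of_heq h2
      exact Or.inr ⟨rfl, g, rfl, hfg⟩
    | mayPair => exact (branch_ne_pair hS.symm).elim
  exact key _ h rfl

theorem pair_inv {q : Pol} {S T X : STree Tag} (h : Trans p σ (pair q S T) X) :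
    (q = p ∧ σ = Msg.chan S ∧ X = T) ∨
    (q = p.flip ∧ ∃ T', X = pair q S T' ∧ Trans p σ T T') := by
  have key : ∀ Y, Trans p σ Y X → Y = pair q S T → (q = p ∧ σ = Msg.chan S ∧ X = T) ∨
    (q = p.flip ∧ ∃ T', X = pair q S T' ∧ Trans p σ T T') := by
    intro Y h hS
    cases h.step with
    | mustUnit => exact (unit_ne_pair hS).elim
    | mustBranch => exact (branch_ne_pair hS).elim
    | mustPair =>
      obtain ⟨rfl, rfl, rfl⟩ := pair_inj hS
      exact Or.inl ⟨rfl, rfl, rfl⟩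
    | mayBranch => exact (branch_ne_pair hS).elim
    | mayPair _ S' T' U hU =>
      obtain ⟨rfl, rfl, rfl⟩ := pair_inj hS
      exact Or.inr ⟨rfl, U, rfl, hU⟩
  exact key _ h rfl

/-- An early output and a late input of the same type commute. -/
theorem diamond {τ : Msg Tag} {R R₁ R₂ : STree Tag} (h₁ : Trans p σ R R₁)
    (h₂ : Trans p.flip τ R R₂) : ∃ R₃, Trans p.flip τ R₁ R₃ ∧ Trans p σ R₂ R₃ := by
  -- At each node the polarity makes one of the two transitions immediate and forces the other to
  -- act below the root, so the square closes without recursion. A unit node admits only one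
  -- polarity of labels.
  rcases R.eq_cases with ⟨q, rfl⟩ | ⟨q, I, hI, ann, f, rfl⟩ | ⟨q, T, U, rfl⟩
  · obtain ⟨rfl, -⟩ := h₁.unit_inv
    exact (q.flip_ne h₂.unit_inv.1.symm).elim
  · rcases h₁.branch_inv with ⟨rfl, k, rfl, rfl⟩ | ⟨rfl, g, rfl, hg⟩
    · rcases h₂.branch_inv with ⟨h, -⟩ | ⟨-, g, rfl, hg⟩
      · exact (q.flip_ne h.symm).elim
      · exact ⟨g k, hg k, .mustBranch k⟩
    · rcases h₂.branch_inv with ⟨-, k, rfl, rfl⟩ | ⟨h, -⟩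
      · exact ⟨g k, .mustBranch k, hg k⟩
      · exact (p.flip.flip_ne h.symm).elim
  · rcases h₁.pair_inv with ⟨rfl, rfl, rfl⟩ | ⟨rfl, T', rfl, hT⟩
    · rcases h₂.pair_inv with ⟨h, -⟩ | ⟨-, T', rfl, hT⟩
      · exact (q.flip_ne h.symm).elim
      · exact ⟨T', hT, .mustPair⟩
    · rcases h₂.pair_inv with ⟨-, rfl, rfl⟩ | ⟨h, -⟩
      · exact ⟨T', .mustPair, hT⟩
      · exact (p.flip.flip_ne h.symm).elim

/-- The label fixes the target of an immediate transition, and a late or early one keeps the root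
and acts on the children, so two targets of the same source are bisimilar. -/
theorem deterministic {S T T' : STree Tag} (h : Trans p σ S T) (h' : Trans p σ S T') : T = T' := by
  refine eq_of_bisim (fun T T' => ∃ S, Trans p σ S T ∧ Trans p σ S T') ?_ ⟨S, h, h'⟩
  rintro T T' ⟨S, h, h'⟩
  rcases S.eq_cases with ⟨q, rfl⟩ | ⟨q, I, hI, ann, f, rfl⟩ | ⟨q, U, V, rfl⟩
  · exact Or.inl (h.unit_inv.2.2.trans h'.unit_inv.2.2.symm)
  · rcases h.branch_inv with ⟨rfl, k, rfl, rfl⟩ | ⟨rfl, g, rfl, hg⟩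
    · rcases h'.branch_inv with ⟨-, k', hk, rfl⟩ | ⟨h, -⟩
      · injection hk with _ hk
        exact Or.inl (congrArg f (Subtype.ext hk))
      · exact (q.flip_ne h.symm).elim
    · rcases h'.branch_inv with ⟨h, -⟩ | ⟨-, g', rfl, hg'⟩
      · exact (p.flip_ne h).elim
      · exact Or.inr (Or.inl ⟨_, _, _, _, _, _, rfl, rfl, fun i => ⟨f i, hg i, hg' i⟩⟩)
  · rcases h.pair_inv with ⟨rfl, rfl, rfl⟩ | ⟨rfl, V', rfl, hV⟩
    · rcases h'.pair_inv with ⟨-, -, rfl⟩ | ⟨h, -⟩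
      · exact Or.inl rfl
      · exact (q.flip_ne h.symm).elim
    · rcases h'.pair_inv with ⟨h, -⟩ | ⟨-, V'', rfl, hV'⟩
      · exact (p.flip_ne h).elim
      · exact Or.inr (Or.inr ⟨_, _, _, _, _, rfl, rfl, Or.inl rfl, V, hV, hV'⟩)

theorem target_cases {S T : STree Tag} (h : Trans p σ S T) :
    Subtree S T ∨
    (∃ I hI ann f g, S = branch p.flip I hI ann f ∧ T = branch p.flip I hI ann g ∧
      ∀ i, Trans p σ (f i) (g i)) ∨
    ∃ U V V', S = pair p.flip U V ∧ T = pair p.flip U V' ∧ Trans p σ V V' := by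
  rcases S.eq_cases with ⟨q, rfl⟩ | ⟨q, I, hI, ann, f, rfl⟩ | ⟨q, U, V, rfl⟩
  · exact Or.inl (h.unit_inv.2.2 ▸ .refl _)
  · rcases h.branch_inv with ⟨rfl, k, rfl, rfl⟩ | ⟨rfl, g, rfl, hg⟩
    · exact Or.inl (subtree_branch _ _ _ _ f k)
    · exact Or.inr (Or.inl ⟨_, _, _, _, _, rfl, rfl, hg⟩)
  · rcases h.pair_inv with ⟨rfl, rfl, rfl⟩ | ⟨rfl, V', rfl, hV⟩
    · exact Or.inl (subtree_pair_right _ _ _)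
    · exact Or.inr (Or.inr ⟨_, _, _, rfl, rfl, hV⟩)

/-- A subtree of the target of a transition is a subtree of the source or the target of a
transition of a subtree of the source. -/
theorem subtree_target {S T U : STree Tag} (h : Trans p σ S T) (hU : Subtree T U) :
    Subtree S U ∨ ∃ V, Subtree S V ∧ Trans p σ V U := by
  refine Subtree.path_induction (motive := fun T => ∀ S, Trans p σ S T →
    Subtree S U ∨ ∃ V, Subtree S V ∧ Trans p σ V U) ?_ ?_ ?_ ?_ hU S h
  · exact fun S h => Or.inr ⟨S, .refl S, h⟩
  · intro q I hI ann g i hi ih S h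
    rcases h.target_cases with h | ⟨I, hI, ann, f, g', rfl, hg, hfg⟩ | ⟨_, _, _, -, h, -⟩
    · exact Or.inl (h.trans ((subtree_branch _ _ _ _ g i).trans hi))
    · obtain ⟨rfl, rfl, h1, h2⟩ := branch_inj hg
      obtain rfl := eq_of_heq h2
      have hs := subtree_branch p.flip _ hI ann f i
      exact (ih _ (hfg i)).imp hs.trans fun ⟨X, hX, h⟩ => ⟨X, hs.trans hX, h⟩
    · exact (branch_ne_pair h).elim
  -- The transition never touches the exchanged component of a pair, so a path that turns left here
  -- already lies in the source.
  · intro q V W hV _ S h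
    rcases h.target_cases with h | ⟨_, _, _, _, _, -, h, -⟩ | ⟨_, _, _, rfl, hV', -⟩
    · exact Or.inl (h.trans ((subtree_pair_left _ _ _).trans hV))
    · exact (branch_ne_pair h.symm).elim
    · obtain ⟨rfl, rfl, rfl⟩ := pair_inj hV'
      exact Or.inl ((subtree_pair_left _ _ _).trans hV)
  · intro q V W hW ih S h
    rcases h.target_cases with h | ⟨_, _, _, _, _, -, h, -⟩ | ⟨_, _, _, rfl, hV', h⟩
    · exact Or.inl (h.trans ((subtree_pair_right _ _ _).trans hW))
    · exact (branch_ne_pair h.symm).elim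
    · obtain ⟨rfl, rfl, rfl⟩ := pair_inj hV'
      have hs := subtree_pair_right p.flip V ‹_›
      exact (ih _ h).imp hs.trans fun ⟨X, hX, h⟩ => ⟨X, hs.trans hX, h⟩

/-- By `subtree_target` every subtree of `T` is a subtree of `S` or the σ-target of one; there are
finitely many sources, and determinism gives each at most one target. -/
theorem regular {S T : STree Tag} (h : Trans p σ S T) (hS : S.Regular) : T.Regular := by
  refine (hS.union (hS.biUnion (t := fun V => {U | Trans p σ V U}) fun V _ => ?_)).subset ?_
  · exact Set.Subsingleton.finite fun U hU U' hU' => hU.deterministic hU'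
  · intro U hU
    exact (h.subtree_target hU).imp id fun ⟨V, hV, h⟩ => Set.mem_biUnion hV h

/-- The finite derivation leads to the node where `U` is actually exchanged. A purely coinductive
derivation could postpone that node forever, with an arbitrary `U` in the label. -/
theorem subtree_chan {S T U : STree Tag} (h : Trans p (Msg.chan U) S T) : Subtree S U := by
  have key : ∀ σ S T, IndTrans p σ S T → σ = Msg.chan U → Subtree S U := by
    intro σ S T h hσ
    induction h with
    | mustUnit => cases hσ
    | mustBranch => cases hσ
    | mustPair S T =>
      cases hσ
      exact subtree_pair_left _ _ _
    -- Nonemptiness of the tag set provides a branch along which to look for the exchange.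
    | mayBranch σ I hI ann f g _ ih =>
      obtain ⟨a, ha⟩ := hI
      exact (subtree_branch _ _ _ _ f ⟨a, ha⟩).trans (ih _ hσ)
    | mayPair σ S T T' _ ih => exact (subtree_pair_right _ _ _).trans (ih hσ)
    | fairBranch σ I hI ann f g k _ ih => exact (subtree_branch _ _ _ _ f k).trans (ih hσ)
  exact key _ _ _ h.ind rfl

end Trans

/-- The dual of a message: only the type of a channel is affected. -/
def Msg.dual : Msg Tag → Msg Tag
  | .star => .star
  | .tag m a => .tag m a
  | .chan S => .chan S.dual

theorem IndTrans.dual {p : Pol} {σ : Msg Tag} {S T : STree Tag} (h : IndTrans p σ S T) :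
    IndTrans p.flip σ.dual S.dual T.dual := by
  induction h with
  | mustUnit =>
    rw [dual_unit]
    exact .mustUnit
  | mustBranch I hI ann f k =>
    rw [dual_branch]
    exact .mustBranch I hI ann _ k
  | mustPair S T =>
    rw [dual_pair]
    exact .mustPair _ _
  | mayBranch σ I hI ann f g _ ih =>
    rw [dual_branch, dual_branch]
    exact .mayBranch _ I hI ann _ _ ih
  | mayPair σ S T T' _ ih =>
    rw [dual_pair, dual_pair]
    exact .mayPair _ _ _ _ ih
  | fairBranch σ I hI ann f g k _ ih =>
    rw [dual_branch, dual_branch]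
    exact .fairBranch _ I hI ann _ _ k ih

theorem Trans.dual {p : Pol} {σ : Msg Tag} {S T : STree Tag} (h : Trans p σ S T) :
    Trans p.flip σ.dual S.dual T.dual := by
  refine ⟨fun S' T' => ∃ S T, Trans p σ S T ∧ S' = S.dual ∧ T' = T.dual, ?_, S, T, h, rfl, rfl⟩
  rintro _ _ ⟨S, T, h, rfl, rfl⟩
  refine ⟨?_, h.ind.dual⟩
  cases h.step with
  | mustUnit =>
    rw [dual_unit]
    exact .mustUnit
  | mustBranch I hI ann f k =>
    rw [dual_branch]
    exact .mustBranch I hI ann _ k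
  | mustPair S T =>
    rw [dual_pair]
    exact .mustPair _ _
  | mayBranch _ I hI ann f g hfg =>
    rw [dual_branch, dual_branch]
    exact .mayBranch _ I hI ann _ _ fun i => ⟨f i, g i, hfg i, rfl, rfl⟩
  | mayPair _ S T T' hT =>
    rw [dual_pair, dual_pair]
    exact .mayPair _ _ _ _ ⟨T, T', hT, rfl, rfl⟩

end CaP

namespace CaP

open STree

variable {Tag : Type}

/-! ### Correct composition -/

/-- The lifting of a relation on trees to messages. -/
inductive Msg.Rel (R : STree Tag → STree Tag → Prop) : Msg Tag → Msg Tag → Prop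
  | star : Rel R .star .star
  | tag (m : ℕ) (a : Tag) : Rel R (.tag m a) (.tag m a)
  | chan {S T : STree Tag} : R S T → Rel R (.chan S) (.chan T)

theorem Msg.Rel.mono {R R' : STree Tag → STree Tag → Prop} (h : ∀ S T, R S T → R' S T)
    {σ τ : Msg Tag} (hσ : Msg.Rel R σ τ) : Msg.Rel R' σ τ := by
  cases hσ with
  | star => exact .star
  | tag m a => exact .tag m a
  | chan hR => exact .chan (h _ _ hR)

/-- Every output of `S` is matched by an input of `T`, up to `R`. -/
def OutSim (R : STree Tag → STree Tag → Prop) (S T : STree Tag) : Prop :=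
  ∀ σ S', Trans .out σ S S' → ∃ τ T', Trans .inp τ T T' ∧ Msg.Rel R σ τ ∧ R S' T'

theorem OutSim.mono {R R' : STree Tag → STree Tag → Prop} (h : ∀ S T, R S T → R' S T)
    {S T : STree Tag} (hS : OutSim R S T) : OutSim R' S T := fun σ S' h' =>
  let ⟨τ, T', hT, hσ, hR⟩ := hS σ S' h'
  ⟨τ, T', hT, hσ.mono h, h _ _ hR⟩

theorem IsCorrect.outSim_left {R : STree Tag → STree Tag → Prop} (hR : IsCorrect R)
    {S T : STree Tag} (h : R S T) : OutSim R S T := by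
  intro σ S' hS
  cases σ with
  | star =>
    obtain ⟨T', hT, hR'⟩ := hR.outStarL _ _ h _ hS
    exact ⟨_, T', hT, .star, hR'⟩
  | tag m a =>
    obtain ⟨T', hT, hR'⟩ := hR.outTagL _ _ h _ _ _ hS
    exact ⟨_, T', hT, .tag m a, hR'⟩
  | chan S₁ =>
    obtain ⟨T₁, T', hT, hR₁, hR'⟩ := hR.outChanL _ _ h _ _ hS
    exact ⟨_, T', hT, .chan hR₁, hR'⟩

theorem IsCorrect.swap {R : STree Tag → STree Tag → Prop} (hR : IsCorrect R) :
    IsCorrect (fun S T => R T S) where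
  pos _ _ h := (hR.pos _ _ h).symm
  outStarL _ _ h := hR.outStarR _ _ h
  outStarR _ _ h := hR.outStarL _ _ h
  outTagL _ _ h := hR.outTagR _ _ h
  outTagR _ _ h := hR.outTagL _ _ h
  outChanL _ _ h := hR.outChanR _ _ h
  outChanR _ _ h := hR.outChanL _ _ h

/-- For a symmetric relation the clauses for the right component are those for the left one with the
roles exchanged. -/
theorem isCorrect_of_symmetric {R : STree Tag → STree Tag → Prop} (hs : ∀ S T, R S T → R T S)
    (hp : ∀ S T, R S T → S.Pos ∨ T.Pos) (ho : ∀ S T, R S T → OutSim R S T) : IsCorrect R := by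
  have star : ∀ S T, R S T → ∀ S', Trans Pol.out Msg.star S S' →
      ∃ T', Trans Pol.inp Msg.star T T' ∧ R S' T' := by
    intro S T h S' hS
    obtain ⟨_, T', hT, ⟨⟩, hR⟩ := ho S T h _ _ hS
    exact ⟨T', hT, hR⟩
  have tag : ∀ S T, R S T → ∀ m a S', Trans Pol.out (Msg.tag m a) S S' →
      ∃ T', Trans Pol.inp (Msg.tag m a) T T' ∧ R S' T' := by
    intro S T h m a S' hS
    obtain ⟨_, T', hT, ⟨⟩, hR⟩ := ho S T h _ _ hS
    exact ⟨T', hT, hR⟩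
  have chan : ∀ S T, R S T → ∀ S₁ S₂, Trans Pol.out (Msg.chan S₁) S S₂ →
      ∃ T₁ T₂, Trans Pol.inp (Msg.chan T₁) T T₂ ∧ R S₁ T₁ ∧ R S₂ T₂ := by
    intro S T h S₁ S₂ hS
    obtain ⟨_, T', hT, hσ, hR⟩ := ho S T h _ _ hS
    cases hσ with
    | chan h₁ => exact ⟨_, T', hT, h₁, hR⟩
  refine ⟨hp, star, fun S T h T' hT => ?_, tag, fun S T h m a T' hT => ?_, chan,
    fun S T h T₁ T₂ hT => ?_⟩
  · obtain ⟨S', h, hR⟩ := star _ _ (hs _ _ h) _ hT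
    exact ⟨S', h, hs _ _ hR⟩
  · obtain ⟨S', h, hR⟩ := tag _ _ (hs _ _ h) _ _ _ hT
    exact ⟨S', h, hs _ _ hR⟩
  · obtain ⟨S₁, S', h, h₁, hR⟩ := chan _ _ (hs _ _ h) _ _ hT
    exact ⟨S₁, S', h, hs _ _ h₁, hs _ _ hR⟩

/-! ### Coinductive arguments about correct composition -/

namespace STree

/-- Correct asynchronous composition of trees that need not be regular. -/
def Correct (S T : STree Tag) : Prop :=
  ∃ R : STree Tag → STree Tag → Prop, IsCorrect R ∧ R S T

namespace Correct

variable {R S T V W : STree Tag}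

theorem symm (h : Correct S T) : Correct T S :=
  let ⟨_, hR, hST⟩ := h
  ⟨_, hR.swap, hST⟩

theorem pos (h : Correct S T) : S.Pos ∨ T.Pos :=
  let ⟨_, hR, hST⟩ := h
  hR.pos _ _ hST

theorem outSim (h : Correct S T) : OutSim Correct S T :=
  let ⟨R, hR, hST⟩ := h
  (hR.outSim_left hST).mono fun _ _ h => ⟨R, hR, h⟩

/-- Coinduction principle for correct composition. -/
theorem coind (A : STree Tag → STree Tag → Prop) (hp : ∀ S T, A S T → S.Pos ∨ T.Pos)
    (hl : ∀ S T, A S T → OutSim (fun S T => Correct S T ∨ A S T ∨ A T S) S T)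
    (hr : ∀ S T, A S T → OutSim (fun S T => Correct S T ∨ A S T ∨ A T S) T S)
    (h : A S T) : Correct S T := by
  -- The candidate is closed under symmetry and enlarged with correct composition itself, so a proof
  -- by coinduction may stop as soon as it reaches a known pair.
  refine ⟨fun S T => Correct S T ∨ A S T ∨ A T S, isCorrect_of_symmetric ?_ ?_ ?_, Or.inr (Or.inl h)⟩
  · exact fun S T h => h.imp symm Or.symm
  · exact fun S T h => h.elim pos fun h => h.elim (hp _ _) fun h => (hp _ _ h).symm
  · exact fun S T h => h.elim (fun h => h.outSim.mono fun _ _ => Or.inl)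
      fun h => h.elim (hl _ _) (hr _ _)

/-- Dualizing a transition derivation turns every output of `S` into an input of its dual, and dual
trees have opposite polarities at the root. -/
theorem dual_right (S : STree Tag) : Correct S S.dual := by
  have key : ∀ S : STree Tag, OutSim (fun S T => T = S.dual) S S.dual := by
    intro S σ S' h
    refine ⟨σ.dual, S'.dual, h.dual, ?_, rfl⟩
    cases σ
    · exact .star
    · exact .tag _ _
    · exact .chan rfl
  refine coind (fun S T => T = S.dual) ?_ ?_ ?_ rfl
  · rintro S _ rfl
    unfold STree.Pos
    rw [pol_dual]
    cases S.pol
    · exact Or.inl rfl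
    · exact Or.inr rfl
  · rintro S _ rfl
    exact (key S).mono fun _ _ h => Or.inr (Or.inl h)
  · rintro S _ rfl
    have := key S.dual
    rw [dual_dual] at this
    exact this.mono fun _ _ h => Or.inr (Or.inl h)

/-- Composition of `R ⋈ Sᗮ` and `S ⋈ T`. -/
theorem cut (hR : Correct R S.dual) (hT : Correct S T) : Correct R T := by
  have key : ∀ {R S T : STree Tag}, Correct R S.dual → Correct S T →
      OutSim (fun R T => ∃ S : STree Tag, Correct R S.dual ∧ Correct S T) R T := by
    intro R S T hR hT σ R' h
    obtain ⟨τ, S', hS, hσ, hR'⟩ := hR.outSim _ _ h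
    -- The input by which Sᗮ answers `R` is, dualized, an output of `S`, which `T` has to answer in
    -- turn.
    have hS' := hS.dual
    rw [dual_dual] at hS'
    obtain ⟨υ, T', hT', hτ, hST⟩ := hT.outSim _ _ hS'
    refine ⟨υ, T', hT', ?_, S'.dual, by rwa [dual_dual], hST⟩
    cases hσ with
    | star => cases hτ with | star => exact .star
    | tag m a => cases hτ with | tag => exact .tag m a
    | @chan R₁ S₁ h₁ => cases hτ with | chan h₂ => exact .chan ⟨S₁.dual, by rwa [dual_dual], h₂⟩
  refine coind (fun R T => ∃ S : STree Tag, Correct R S.dual ∧ Correct S T) ?_ ?_ ?_ ⟨S, hR, hT⟩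
  · rintro R T ⟨S, hR, hT⟩
    have h₁ := hR.pos
    have h₂ := hT.pos
    unfold STree.Pos at *
    rw [pol_dual] at h₁
    -- Exactly one of `S` and Sᗮ is positive, so the partner of the negative one has to be positive.
    cases hS : S.pol
    · rw [hS] at h₁
      exact h₁.imp id nofun
    · rw [hS] at h₂
      exact Or.inr (h₂.resolve_left nofun)
  · rintro R T ⟨S, hR, hT⟩
    exact (key hR hT).mono fun _ _ h => Or.inr (Or.inl h)
  · rintro R T ⟨S, hR, hT⟩
    have hT' : Correct T S.dual.dual := by
      rw [dual_dual]
      exact hT.symm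
    exact (key hT' hR.symm).mono fun _ _ h => Or.inr (Or.inl h)

end Correct

/-- `Prefix W τ V`: the only output of `W` at its root is the message `τ`, with continuation `V`. -/
inductive Prefix : STree Tag → Msg Tag → STree Tag → Prop
  | select (m : ℕ) (a : Tag) (V : STree Tag) :
      Prefix (branch .out {a} (Finset.singleton_nonempty a) (fun _ => m) (fun _ => V)) (.tag m a) V
  | pair (S V : STree Tag) : Prefix (pair .out S V) (.chan S) V

namespace Prefix

variable {V W : STree Tag} {τ : Msg Tag}

theorem pos (h : Prefix W τ V) : W.Pos := by
  cases h
  · exact pol_branch _ _ _ _ _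
  · exact pol_pair _ _ _

theorem out_inv (h : Prefix W τ V) {σ : Msg Tag} {W' : STree Tag} (hW : Trans .out σ W W') :
    σ = τ ∧ W' = V := by
  cases h with
  | select m a V =>
    rcases hW.branch_inv with ⟨-, ⟨k, hk⟩, rfl, rfl⟩ | ⟨h, -⟩
    · exact ⟨congrArg (Msg.tag m) (Finset.mem_singleton.1 hk), rfl⟩
    · cases h
  | pair S V =>
    rcases hW.pair_inv with ⟨-, rfl, rfl⟩ | ⟨h, -⟩
    · exact ⟨rfl, rfl⟩
    · cases h

theorem late (h : Prefix W τ V) {σ : Msg Tag} {V' : STree Tag} (hV : Trans .inp σ V V') :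
    ∃ W', Trans .inp σ W W' ∧ Prefix W' τ V' := by
  cases h with
  | select m a V => exact ⟨_, Trans.mayBranch (p := .inp) fun _ => hV, .select m a V'⟩
  | pair S V => exact ⟨_, Trans.mayPair (p := .inp) hV, .pair S V'⟩

end Prefix

/-- The invariant is that `R` can input the pending message early and thereby reach a partner of
`V`. An output of `R` survives this anticipated input by the diamond, and `W` answers it by a late
input below its prefix. The only output of `W` is absorbed by the anticipated input itself. -/
theorem Correct.prefix_right {R R' V W : STree Tag} {τ τ' : Msg Tag} (hW : Prefix W τ V)
    (hR : Trans .inp τ' R R') (hτ : Msg.Rel Correct τ τ') (h : Correct R' V) : Correct R W := by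
  refine coind (fun R W => ∃ R' V τ τ', Prefix W τ V ∧ Trans .inp τ' R R' ∧
    Msg.Rel Correct τ τ' ∧ Correct R' V) ?_ ?_ ?_ ⟨R', V, τ, τ', hW, hR, hτ, h⟩
  · rintro R W ⟨R', V, τ, τ', hW, -⟩
    exact Or.inr hW.pos
  · rintro R W ⟨R', V, τ, τ', hW, hR, hτ, h⟩ σ R₁ hR₁
    obtain ⟨R₃, hR₃, hR'⟩ := hR₁.diamond hR
    obtain ⟨υ, V', hV, hσ, h'⟩ := h.outSim _ _ hR'
    obtain ⟨W', hW', hp⟩ := hW.late hV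
    exact ⟨υ, W', hW', hσ.mono fun _ _ => Or.inl, Or.inr (Or.inl ⟨R₃, V', τ, τ', hp, hR₃, hτ, h'⟩)⟩
  · rintro R W ⟨R', V, τ, τ', hW, hR, hτ, h⟩ σ W' hW'
    obtain ⟨rfl, rfl⟩ := hW.out_inv hW'
    exact ⟨τ', R', hR, hτ.mono fun _ _ => Or.inl, Or.inl h.symm⟩

end STree

/-! ### Subtyping -/

theorem SType.dual_dual (S : SType Tag) : S.dual.dual = S := Subtype.ext (STree.dual_dual S.1)

theorem Correct.symm {S T : SType Tag} (h : Correct S T) : Correct T S := STree.Correct.symm h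

theorem Sub.refl (S : SType Tag) : Sub S S := fun _ h => h

theorem Sub.trans {S T U : SType Tag} (h : Sub S T) (h' : Sub T U) : Sub S U :=
  fun R hR => h R (h' R hR)

theorem Correct.mono {S S' T T' : SType Tag} (h : Correct S T) (hS : Sub S' S) (hT : Sub T' T) :
    Correct S' T' :=
  (hS _ (hT _ h).symm).symm

/-- Any partner of Sᗮ can be composed with S ⋈ T through the intermediate type `S`. -/
theorem Correct.sub_dual {S T : SType Tag} (h : Correct S T) : Sub T S.dual :=
  fun _ hR => STree.Correct.cut hR h

/-- Since Tᗮ ⋈ T, the hypothesis gives Tᗮ ⋈ Sᗮ, which reads as a subtyping with the double dual of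
`S`. This makes the typing rule of links symmetric. -/
theorem Sub.dual_comm {S T : SType Tag} (h : Sub S.dual T) : Sub T.dual S := by
  have h' := (h T.dual (STree.Correct.dual_right T.1).symm).symm.sub_dual
  rwa [SType.dual_dual] at h'

/-- The type that outputs a single tag. -/
def SType.select (m : ℕ) (a : Tag) (S : SType Tag) : SType Tag :=
  .branch .out {a} (Finset.singleton_nonempty a) (fun _ => m) (fun _ => S)

/-- A partner of `S` must be able to input the tag, and its residual, which is regular, composes
with `V` and hence with `V'`. Prefixing the output restores the original partner. -/
theorem Sub.select {S V V' : SType Tag} {m : ℕ} {a : Tag} (h : Trans .out (.tag m a) S.1 V.1)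
    (hV : Sub V' V) : Sub (.select m a V') S := by
  intro R hR
  obtain ⟨_, R', hR', ⟨⟩, h'⟩ := STree.Correct.outSim hR.symm _ _ h
  exact STree.Correct.prefix_right (.select m a V'.1) hR' (.tag m a)
    (hV ⟨R', hR'.regular R.2⟩ (STree.Correct.symm h'))

/-- As for tags, except that the type received by the partner also has to be regular, which holds
because it is a subtree of the partner. -/
theorem Sub.pair {S V V' U U' : SType Tag} (h : Trans .out (.chan U.1) S.1 V.1) (hU : Sub U' U)
    (hV : Sub V' V) : Sub (.pair .out U' V') S := by
  intro R hR
  obtain ⟨_, R', hR', hσ, h'⟩ := STree.Correct.outSim hR.symm _ _ h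
  cases hσ with
  | @chan _ R₁ h₁ =>
    have h₂ : Correct ⟨R₁, R.2.of_subtree hR'.subtree_chan⟩ U := STree.Correct.symm h₁
    exact STree.Correct.prefix_right (.pair U'.1 V'.1) hR' (.chan (hU _ h₂).symm)
      (hV ⟨R', hR'.regular R.2⟩ (STree.Correct.symm h'))

end CaP

namespace CaP

variable {Tag Name : Type}

/-! ### Renaming -/

theorem lift_id : lift id = id := by
  funext i
  cases i <;> rfl

theorem lift_comp (ρ ρ' : ℕ → ℕ) : lift ρ ∘ lift ρ' = lift (ρ ∘ ρ') := by
  funext i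
  cases i <;> rfl

namespace Proc

theorem ren_congr {P : Proc Tag Name} : ∀ {ρ ρ' : ℕ → ℕ}, (∀ i ∈ P.fn, ρ i = ρ' i) →
    P.ren ρ = P.ren ρ' := by
  have hl : ∀ {s : Set ℕ} {ρ ρ' : ℕ → ℕ}, (∀ i, i + 1 ∈ s → ρ i = ρ' i) →
      ∀ i ∈ s, lift ρ i = lift ρ' i := by
    intro s ρ ρ' h i hi
    cases i
    · rfl
    · exact congrArg (· + 1) (h _ hi)
  induction P with
  | link x y => intro ρ ρ' h; simp_all [ren, fn]
  | close x => intro ρ ρ' h; simp_all [ren, fn]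
  | select x a P ih =>
    intro ρ ρ' h
    simp only [fn, Set.mem_union, Set.mem_singleton_iff] at h
    simp only [ren, h x (Or.inl rfl), ih fun i hi => h i (Or.inr hi)]
  | fork x P Q ihP ihQ =>
    intro ρ ρ' h
    simp only [fn, Set.mem_union, Set.mem_singleton_iff, Set.mem_ofPred_eq] at h
    simp only [ren, h x (Or.inl (Or.inl rfl)), ihP (hl fun i hi => h i (Or.inl (Or.inr hi))),
      ihQ fun i hi => h i (Or.inr hi)]
  | choice P Q ihP ihQ =>
    intro ρ ρ' h
    simp only [fn, Set.mem_union] at h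
    simp only [ren, ihP fun i hi => h i (Or.inl hi), ihQ fun i hi => h i (Or.inr hi)]
  | done => intros; rfl
  | call A xs =>
    intro ρ ρ' h
    simp only [ren, List.map_congr_left h]
  | wait x P ih =>
    intro ρ ρ' h
    simp only [fn, Set.mem_union, Set.mem_singleton_iff] at h
    simp only [ren, h x (Or.inl rfl), ih fun i hi => h i (Or.inr hi)]
  | case x I P ih =>
    intro ρ ρ' h
    simp only [fn, Set.mem_union, Set.mem_singleton_iff, Set.mem_ofPred_eq] at h
    simp only [ren, h x (Or.inl rfl), fun a => ih a fun i hi => h i (Or.inr ⟨a, hi⟩)]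
  | join x P ih =>
    intro ρ ρ' h
    simp only [fn, Set.mem_union, Set.mem_singleton_iff, Set.mem_ofPred_eq] at h
    simp only [ren, h x (Or.inl rfl), ih (hl fun i hi => h i (Or.inr hi))]
  | cut P Q ihP ihQ =>
    intro ρ ρ' h
    simp only [fn, Set.mem_union, Set.mem_ofPred_eq] at h
    simp only [ren, ihP (hl fun i hi => h i (Or.inl hi)), ihQ (hl fun i hi => h i (Or.inr hi))]

theorem ren_ren (P : Proc Tag Name) : ∀ ρ ρ' : ℕ → ℕ, (P.ren ρ').ren ρ = P.ren (ρ ∘ ρ') := by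
  induction P <;> intro ρ ρ' <;> simp_all [ren, lift_comp]

theorem ren_id (P : Proc Tag Name) : P.ren id = P := by
  induction P <;> simp_all [ren, lift_id]

theorem mem_fn_ren {P : Proc Tag Name} : ∀ {ρ : ℕ → ℕ} {i : ℕ}, i ∈ (P.ren ρ).fn →
    ∃ j ∈ P.fn, ρ j = i := by
  have hl : ∀ {s : Set ℕ} {ρ : ℕ → ℕ} {i : ℕ}, (∃ j ∈ s, lift ρ j = i + 1) →
      ∃ j, j + 1 ∈ s ∧ ρ j = i := by
    rintro s ρ i ⟨_ | j, hj, h⟩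
    · cases h
    · exact ⟨j, hj, Nat.succ_injective h⟩
  induction P with
  | link x y => intro ρ i h; simp_all [ren, fn, eq_comm]
  | close x => intro ρ i h; simp_all [ren, fn]
  | select x a P ih =>
    rintro ρ i (rfl | h)
    · exact ⟨x, Or.inl rfl, rfl⟩
    · exact (ih h).imp fun j h => ⟨Or.inr h.1, h.2⟩
  | fork x P Q ihP ihQ =>
    rintro ρ i ((rfl | h) | h)
    · exact ⟨x, Or.inl (Or.inl rfl), rfl⟩
    · exact (hl (ihP h)).imp fun j h => ⟨Or.inl (Or.inr h.1), h.2⟩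
    · exact (ihQ h).imp fun j h => ⟨Or.inr h.1, h.2⟩
  | choice P Q ihP ihQ =>
    rintro ρ i (h | h)
    · exact (ihP h).imp fun j h => ⟨Or.inl h.1, h.2⟩
    · exact (ihQ h).imp fun j h => ⟨Or.inr h.1, h.2⟩
  | done => rintro ρ i ⟨⟩
  | call A xs =>
    intro ρ i h
    exact List.mem_map.1 h
  | wait x P ih =>
    rintro ρ i (rfl | h)
    · exact ⟨x, Or.inl rfl, rfl⟩
    · exact (ih h).imp fun j h => ⟨Or.inr h.1, h.2⟩
  | case x I P ih =>
    rintro ρ i (rfl | ⟨a, h⟩)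
    · exact ⟨x, Or.inl rfl, rfl⟩
    · exact (ih a h).imp fun j h => ⟨Or.inr ⟨a, h.1⟩, h.2⟩
  | join x P ih =>
    rintro ρ i (rfl | h)
    · exact ⟨x, Or.inl rfl, rfl⟩
    · exact (hl (ih h)).imp fun j h => ⟨Or.inr h.1, h.2⟩
  | cut P Q ihP ihQ =>
    rintro ρ i (h | h)
    · exact (hl (ihP h)).imp fun j h => ⟨Or.inl h.1, h.2⟩
    · exact (hl (ihQ h)).imp fun j h => ⟨Or.inr h.1, h.2⟩

end Proc

/-- Beyond the parameters the lookup returns the default 0, which renaming would not preserve. The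
free channels of a body are below its arity, so the default is never reached. -/
theorem Program.ren_unfold (D : Program Tag Name) {A : Name} {xs : List ℕ}
    (h : xs.length = D.arity A) (ρ : ℕ → ℕ) : (D.unfold A xs).ren ρ = D.unfold A (xs.map ρ) := by
  unfold Program.unfold
  rw [Proc.ren_ren]
  refine Proc.ren_congr fun i hi => ?_
  rw [D.fn_body, Set.mem_ofPred_eq, ← h] at hi
  simp [List.getD, hi]

namespace Buf

theorem ren_ren (B : Buf Tag Name) (ρ ρ' : ℕ → ℕ) : (B.ren ρ').ren ρ = B.ren (ρ ∘ ρ') := by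
  induction B <;> simp_all [ren, Proc.ren_ren, lift_comp]

theorem ren_id (B : Buf Tag Name) : B.ren id = B := by
  induction B <;> simp_all [ren, lift_id, Proc.ren_id]

end Buf

/-! ### Contexts -/

namespace Ctx

/-- The context below a binder whose channel is not used. -/
def shift (Γ : Ctx Tag) : Ctx Tag
  | 0 => none
  | i + 1 => Γ i

@[simp] theorem cons_zero (S : SType Tag) (Γ : Ctx Tag) : cons S Γ 0 = some S := rfl

@[simp] theorem cons_succ (S : SType Tag) (Γ : Ctx Tag) (i : ℕ) : cons S Γ (i + 1) = Γ i := rfl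

@[simp] theorem shift_zero (Γ : Ctx Tag) : shift Γ 0 = none := rfl

@[simp] theorem shift_succ (Γ : Ctx Tag) (i : ℕ) : shift Γ (i + 1) = Γ i := rfl

theorem set_apply (Γ : Ctx Tag) (x o y) : Γ.set x o y = if y = x then o else Γ y :=
  Function.update_apply (β := Option (SType Tag)) Γ x o y

@[simp] theorem set_same (Γ : Ctx Tag) (x o) : Γ.set x o x = o := by simp [set_apply]

theorem set_ne (Γ : Ctx Tag) {x y : ℕ} (o) (h : y ≠ x) : Γ.set x o y = Γ y := by simp [set_apply, h]

@[simp] theorem empty_apply (x : ℕ) : (empty : Ctx Tag) x = none := rfl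

theorem cons_set_succ (S : SType Tag) (Γ : Ctx Tag) (x o) :
    (cons S Γ).set (x + 1) o = cons S (Γ.set x o) := by
  funext i
  cases i <;> simp [set_apply]

theorem shift_set_succ (Γ : Ctx Tag) (x o) : (shift Γ).set (x + 1) o = shift (Γ.set x o) := by
  funext i
  cases i <;> simp [set_apply]

theorem cons_set_zero (S T : SType Tag) (Γ : Ctx Tag) : (cons S Γ).set 0 (some T) = cons T Γ := by
  funext i
  cases i <;> simp [set_apply]

theorem cons_set_zero_none (S : SType Tag) (Γ : Ctx Tag) : (cons S Γ).set 0 none = shift Γ := by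
  funext i
  cases i <;> simp [set_apply]

theorem shift_set_zero (T : SType Tag) (Γ : Ctx Tag) : (shift Γ).set 0 (some T) = cons T Γ := by
  funext i
  cases i <;> simp [set_apply]

theorem set_set (Γ : Ctx Tag) (x o o') : (Γ.set x o).set x o' = Γ.set x o' := by
  funext i
  simp only [set_apply]
  split <;> rfl

theorem set_eq_self {Γ : Ctx Tag} {x o} (h : Γ x = o) : Γ.set x o = Γ := by
  funext i
  rw [set_apply]
  split
  · subst i; exact h.symm
  · rfl

theorem eq_shift {Γ : Ctx Tag} (h : Γ 0 = none) : Γ = shift (fun i => Γ (i + 1)) := by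
  funext i
  cases i
  · exact h
  · rfl

theorem eq_cons {Γ : Ctx Tag} {S} (h : Γ 0 = some S) : Γ = cons S (fun i => Γ (i + 1)) := by
  funext i
  cases i
  · exact h
  · rfl

theorem Split.eq_left {Γ Γ₁ Γ₂ : Ctx Tag} (h : Split Γ Γ₁ Γ₂) {x : ℕ} (hx : Γ₁ x ≠ none) :
    Γ₁ x = Γ x :=
  (h x).elim And.left fun h => (hx h.1).elim

theorem Split.symm {Γ Γ₁ Γ₂ : Ctx Tag} (h : Split Γ Γ₁ Γ₂) : Split Γ Γ₂ Γ₁ :=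
  fun x => (h x).symm.imp And.symm And.symm

/-- The renaming `ρ` is injective on the domain of `Γ` and maps `Γ` to `Γ'`. -/
structure Ren (ρ : ℕ → ℕ) (Γ Γ' : Ctx Tag) : Prop where
  inj : ∀ x y, Γ x ≠ none → Γ y ≠ none → ρ x = ρ y → x = y
  map : ∀ x, Γ x ≠ none → Γ' (ρ x) = Γ x
  surj : ∀ y, Γ' y ≠ none → ∃ x, Γ x ≠ none ∧ ρ x = y

namespace Ren

variable {ρ : ℕ → ℕ} {Γ Γ' : Ctx Tag}

theorem of_leftInverse {ρ' : ℕ → ℕ} (h : ∀ x, Γ x ≠ none → ρ' (ρ x) = x ∧ Γ' (ρ x) = Γ x)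
    (h' : ∀ y, Γ' y ≠ none → ρ (ρ' y) = y ∧ Γ (ρ' y) ≠ none) : Ren ρ Γ Γ' where
  inj x y hx hy hxy := by rw [← (h x hx).1, hxy, (h y hy).1]
  map x hx := (h x hx).2
  surj y hy := ⟨ρ' y, (h' y hy).2, (h' y hy).1⟩

theorem map_some (h : Ren ρ Γ Γ') {x : ℕ} {S} (hx : Γ x = some S) : Γ' (ρ x) = some S := by
  rw [h.map x (by simp [hx]), hx]

theorem eq_none (h : Ren ρ Γ Γ') {y : ℕ} (hy : ∀ x, Γ x ≠ none → ρ x ≠ y) : Γ' y = none := by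
  by_contra hne
  obtain ⟨x, hx, hxy⟩ := h.surj y hne
  exact hy x hx hxy

theorem eq_of_map (h : Ren ρ Γ Γ') {Γ'' : Ctx Tag} (h₁ : ∀ x, Γ x ≠ none → Γ'' (ρ x) = Γ x)
    (h₂ : ∀ y, (∀ x, Γ x ≠ none → ρ x ≠ y) → Γ'' y = none) : Γ' = Γ'' := by
  funext y
  by_cases hy : ∃ x, Γ x ≠ none ∧ ρ x = y
  · obtain ⟨x, hx, rfl⟩ := hy
    rw [h.map x hx, h₁ x hx]
  · have hy' : ∀ x, Γ x ≠ none → ρ x ≠ y := fun x hx hxy => hy ⟨x, hx, hxy⟩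
    rw [h.eq_none hy', h₂ y hy']

theorem cons (h : Ren ρ Γ Γ') (S : SType Tag) : Ren (lift ρ) (cons S Γ) (Ctx.cons S Γ') where
  inj
    | 0, 0 => fun _ _ _ => rfl
    | 0, _ + 1 => fun _ _ h => nomatch h
    | _ + 1, 0 => fun _ _ h => nomatch h
    | x + 1, y + 1 => fun hx hy hxy => congrArg (· + 1) (h.inj x y hx hy (Nat.succ_injective hxy))
  map
    | 0 => fun _ => rfl
    | x + 1 => fun hx => h.map x hx
  surj
    | 0 => fun _ => ⟨0, nofun, rfl⟩
    | y + 1 => fun hy =>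
      let ⟨x, hx, hxy⟩ := h.surj y hy
      ⟨x + 1, hx, congrArg (· + 1) hxy⟩

/-- Here `x` need not be in the domain. The rule for channel output needs this: it removes `x`,
splits the context, and only then gives `x` its new type. -/
theorem set_of_fresh (h : Ren ρ Γ Γ') {x : ℕ} (hx : ∀ y, Γ y ≠ none → ρ y = ρ x → y = x) (o) :
    Ren ρ (Γ.set x o) (Γ'.set (ρ x) o) := by
  refine ⟨fun y z hy hz hyz => ?_, fun y hy => ?_, fun y hy => ?_⟩
  · rw [set_apply] at hy hz
    split_ifs at hy hz with h₁ h₂ h₂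
    · exact h₁.trans h₂.symm
    · exact (hx z hz (hyz.symm.trans (congrArg ρ h₁)) ▸ h₁)
    · exact (hx y hy (hyz.trans (congrArg ρ h₂))).trans h₂.symm
    · exact h.inj y z hy hz hyz
  · by_cases hyx : y = x
    · subst hyx; simp
    · rw [set_ne _ _ hyx] at hy ⊢
      rw [set_ne, h.map y hy]
      exact fun h' => hyx (hx y hy h')
  · by_cases hyx : y = ρ x
    · subst hyx
      rw [set_same] at hy
      exact ⟨x, by simpa using hy, rfl⟩
    · rw [set_ne _ _ hyx] at hy
      obtain ⟨z, hz, rfl⟩ := h.surj y hy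
      refine ⟨z, ?_, rfl⟩
      rwa [set_ne]
      rintro rfl
      exact hyx rfl

theorem set (h : Ren ρ Γ Γ') {x : ℕ} (hx : Γ x ≠ none) (o) :
    Ren ρ (Γ.set x o) (Γ'.set (ρ x) o) :=
  h.set_of_fresh (fun y hy => h.inj y x hy hx) o

/-- It suffices to restrict `Γ'` to the image of the domain of `Γ₁`. -/
theorem exists_of_le (h : Ren ρ Γ Γ') {Γ₁ : Ctx Tag} (h₁ : ∀ x, Γ₁ x ≠ none → Γ₁ x = Γ x) :
    ∃ Γ₁', Ren ρ Γ₁ Γ₁' ∧ ∀ y, Γ₁' y ≠ none → Γ₁' y = Γ' y := by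
  classical
  have dom : ∀ x, Γ₁ x ≠ none → Γ x ≠ none := fun x hx => h₁ x hx ▸ hx
  refine ⟨fun y => if ∃ x, Γ₁ x ≠ none ∧ ρ x = y then Γ' y else none, ⟨?_, ?_, ?_⟩, ?_⟩
  · exact fun x y hx hy => h.inj x y (dom x hx) (dom y hy)
  · intro x hx
    rw [if_pos ⟨x, hx, rfl⟩, h.map x (dom x hx), h₁ x hx]
  · intro y hy
    by_contra hne
    exact hy (if_neg hne)
  · intro y hy
    dsimp only at hy ⊢
    split_ifs at hy ⊢
    · rfl
    · exact absurd rfl hy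

theorem split (h : Ren ρ Γ Γ') {Γ₁ Γ₂ : Ctx Tag} (hs : Split Γ Γ₁ Γ₂) :
    ∃ Γ₁' Γ₂', Split Γ' Γ₁' Γ₂' ∧ Ren ρ Γ₁ Γ₁' ∧ Ren ρ Γ₂ Γ₂' := by
  have le₁ : ∀ x, Γ₁ x ≠ none → Γ₁ x = Γ x := fun x => hs.eq_left
  have le₂ : ∀ x, Γ₂ x ≠ none → Γ₂ x = Γ x := fun x => hs.symm.eq_left
  obtain ⟨Γ₁', h₁, -⟩ := h.exists_of_le le₁
  obtain ⟨Γ₂', h₂, -⟩ := h.exists_of_le le₂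
  refine ⟨Γ₁', Γ₂', fun y => ?_, h₁, h₂⟩
  by_cases hy : Γ' y = none
  · rw [hy]
    have : ∀ x, Γ x ≠ none → ρ x ≠ y := by
      rintro x hx rfl
      exact hx ((h.map x hx).symm.trans hy)
    refine Or.inl ⟨h₁.eq_none fun x hx => this x ?_, h₂.eq_none fun x hx => this x ?_⟩
    · exact le₁ x hx ▸ hx
    · exact le₂ x hx ▸ hx
  · obtain ⟨x, hx, rfl⟩ := h.surj y hy
    rcases hs x with ⟨h₁x, h₂x⟩ | ⟨h₁x, h₂x⟩
    · refine Or.inl ⟨?_, h₂.eq_none fun z hz hzx => ?_⟩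
      · rw [h₁.map x (h₁x ▸ hx), h₁x, h.map x hx]
      · obtain rfl := h.inj _ _ (le₂ z hz ▸ hz) hx hzx
        exact hz h₂x
    · refine Or.inr ⟨h₁.eq_none fun z hz hzx => ?_, ?_⟩
      · obtain rfl := h.inj _ _ (le₁ z hz ▸ hz) hx hzx
        exact hz h₁x
      · rw [h₂.map x (h₂x ▸ hx), h₂x, h.map x hx]

end Ren

end Ctx
end CaP

namespace CaP

variable {Tag Name : Type} {D : Program Tag Name}

/-! ### Basic properties of typing -/

theorem TypeStep.mono {R R' : ℕ → Ctx Tag → Proc Tag Name → Prop}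
    (h : ∀ n Γ P, R n Γ P → R' n Γ P) {n : ℕ} {Γ : Ctx Tag} {P : Proc Tag Name}
    (hP : TypeStep D R n Γ P) : TypeStep D R' n Γ P := by
  cases hP with
  | done _ h₁ => exact .done _ h₁
  | call m n _ A xs h₁ h₂ h₃ h₄ => exact .call m n _ A xs h₁ h₂ h₃ (h _ _ _ h₄)
  | link x y S T _ h₁ h₂ h₃ => exact .link x y S T _ h₁ h₂ h₃
  | cut m n _ Γ₁ Γ₂ S T P Q h₁ h₂ h₃ h₄ =>
    exact .cut m n _ Γ₁ Γ₂ S T P Q h₁ h₂ (h _ _ _ h₃) (h _ _ _ h₄)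
  | choiceL m n _ P Q h₁ h₂ => exact .choiceL m n _ P Q (h _ _ _ h₁) (h _ _ _ h₂)
  | choiceR m n _ P Q h₁ h₂ => exact .choiceR m n _ P Q (h _ _ _ h₁) (h _ _ _ h₂)
  | one x _ h₁ => exact .one x _ h₁
  | bot n x P _ h₁ h₂ => exact .bot n x P _ h₁ (h _ _ _ h₂)
  | plus n x P _ I hI ann S k h₁ h₂ => exact .plus n x P _ I hI ann S k h₁ (h _ _ _ h₂)
  | amp n x I J hJI P _ hJ ann S h₁ h₂ =>
    exact .amp n x I J hJI P _ hJ ann S h₁ fun j => h _ _ _ (h₂ j)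
  | tensor m n x P Q _ Γ₁ Γ₂ S T h₁ h₂ h₃ h₄ =>
    exact .tensor m n x P Q _ Γ₁ Γ₂ S T h₁ h₂ (h _ _ _ h₃) (h _ _ _ h₄)
  | par n x P _ S T h₁ h₂ => exact .par n x P _ S T h₁ (h _ _ _ h₂)

theorem Typed.step {n : ℕ} {Γ : Ctx Tag} {P : Proc Tag Name} (h : Typed D n Γ P) :
    TypeStep D (Typed D) n Γ P :=
  let ⟨R, hR, hP⟩ := h
  (hR _ _ _ hP).mono fun _ _ _ h => ⟨R, hR, h⟩

theorem TypeStep.typed {n : ℕ} {Γ : Ctx Tag} {P : Proc Tag Name}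
    (h : TypeStep D (Typed D) n Γ P) : Typed D n Γ P :=
  ⟨TypeStep D (Typed D), fun _ _ _ h => h.mono fun _ _ _ => Typed.step, h⟩

/-- Every channel of the context is free in the process. -/
theorem Typed.mem_fn {P : Proc Tag Name} : ∀ {n : ℕ} {Γ : Ctx Tag}, Typed D n Γ P →
    ∀ {x : ℕ}, Γ x ≠ none → x ∈ P.fn := by
  have hset : ∀ {Γ : Ctx Tag} {x y : ℕ} {o}, Γ x ≠ none → x ≠ y → Γ.set y o x ≠ none := by
    intro Γ x y o hx hxy
    rwa [Ctx.set_ne _ _ hxy]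
  have hsplit : ∀ {Γ Γ₁ Γ₂ : Ctx Tag} {x : ℕ}, Ctx.Split Γ Γ₁ Γ₂ → Γ x ≠ none →
      Γ₁ x ≠ none ∨ Γ₂ x ≠ none := by
    intro Γ Γ₁ Γ₂ x h hx
    rcases h x with ⟨h, -⟩ | ⟨-, h⟩
    · exact Or.inl (h ▸ hx)
    · exact Or.inr (h ▸ hx)
  -- Derivations can be infinite only through invocations, and the rule for these states the domain
  -- outright, so induction on the finite syntax is enough.
  induction P with
  | link x y =>
    intro n Γ h z hz
    cases h.step with
    | link _ _ S T _ _ h =>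
      subst h
      rw [Ctx.set_apply, Ctx.set_apply] at hz
      by_contra hne
      simp only [Proc.fn, Set.mem_insert_iff, Set.mem_singleton_iff, not_or] at hne
      simp [hne] at hz
  | close x =>
    intro n Γ h z hz
    cases h.step with
    | one _ _ h =>
      subst h
      rw [Ctx.set_apply] at hz
      by_contra hne
      simp only [Proc.fn, Set.mem_singleton_iff] at hne
      simp [hne] at hz
  | select x a P ih =>
    intro n Γ h z hz
    by_cases hzx : z = x
    · exact Or.inl hzx
    cases h.step with
    | plus n _ _ _ I hI ann S k h₁ h₂ => exact Or.inr (ih h₂ (hset hz hzx))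
  | fork x P Q ihP ihQ =>
    intro n Γ h z hz
    by_cases hzx : z = x
    · exact Or.inl (Or.inl hzx)
    cases h.step with
    | tensor m n _ _ _ _ Γ₁ Γ₂ S T h₁ h₂ h₃ h₄ =>
      exact (hsplit h₂ (hset hz hzx)).elim
        (fun h => Or.inl (Or.inr (ihP h₃ (x := z + 1) h))) fun h => Or.inr (ihQ h₄ (hset h hzx))
  | choice P Q ihP ihQ =>
    intro n Γ h z hz
    cases h.step with
    | choiceL m n _ _ _ h₁ h₂ => exact Or.inl (ihP h₁ hz)
    | choiceR m n _ _ _ h₁ h₂ => exact Or.inl (ihP h₁ hz)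
  | done =>
    intro n Γ h z hz
    cases h.step with
    | done _ h =>
      subst h
      exact absurd rfl hz
  | call A xs =>
    intro n Γ h z hz
    cases h.step with
    | call m n _ _ _ h₁ h₂ h₃ h₄ => exact (h₃ z).1 hz
  | wait x P ih =>
    intro n Γ h z hz
    by_cases hzx : z = x
    · exact Or.inl hzx
    cases h.step with
    | bot n _ _ _ h₁ h₂ => exact Or.inr (ih h₂ (hset hz hzx))
  | case x I P ih =>
    intro n Γ h z hz
    by_cases hzx : z = x
    · exact Or.inl hzx
    cases h.step with
    | amp n _ _ J hJI _ _ hJ ann S h₁ h₂ =>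
      obtain ⟨a, ha⟩ := id hJ
      exact Or.inr ⟨_, ih _ (h₂ ⟨a, ha⟩) (hset hz hzx)⟩
  | join x P ih =>
    intro n Γ h z hz
    by_cases hzx : z = x
    · exact Or.inl hzx
    cases h.step with
    | par n _ _ _ S T h₁ h₂ => exact Or.inr (ih h₂ (x := z + 1) (hset hz hzx))
  | cut P Q ihP ihQ =>
    intro n Γ h z hz
    cases h.step with
    | cut m n _ Γ₁ Γ₂ S T _ _ h₁ h₂ h₃ h₄ =>
      exact (hsplit h₁ hz).imp (fun h => ihP h₃ (x := z + 1) h) fun h => ihQ h₄ (x := z + 1) h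

/-- Renamed typings form a coinductive candidate, stable under unfolding by `Program.ren_unfold`.
Injectivity is required on the context only, because renamings such as `inst` are not injective
globally. -/
theorem Typed.ren {n : ℕ} {Γ : Ctx Tag} {P : Proc Tag Name} (h : Typed D n Γ P) {ρ : ℕ → ℕ}
    {Γ' : Ctx Tag} (hρ : Ctx.Ren ρ Γ Γ') : Typed D n Γ' (P.ren ρ) := by
  refine ⟨fun n Γ' P' => ∃ ρ Γ P, Ctx.Ren ρ Γ Γ' ∧ P' = Proc.ren ρ P ∧ Typed D n Γ P, ?_,
    ρ, Γ, P, hρ, rfl, h⟩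
  rintro n Γ' _ ⟨ρ, Γ, P, hρ, rfl, h⟩
  have ne : ∀ {x S}, Γ x = some S → Γ x ≠ none := fun h => by simp [h]
  cases h.step with
  | done _ h₁ =>
    subst h₁
    exact .done _ (hρ.eq_of_map (fun _ h => absurd rfl h) fun _ _ => rfl)
  | call m n _ A xs h₁ h₂ h₃ h₄ =>
    refine .call m n _ A _ (by simpa using h₁) (h₂.map_on fun x hx y hy => ?_) (fun y => ?_)
      ⟨ρ, Γ, _, hρ, (D.ren_unfold h₁ ρ).symm, h₄⟩
    · exact hρ.inj x y ((h₃ x).2 hx) ((h₃ y).2 hy)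
    · rw [List.mem_map]
      constructor
      · exact fun hy => (hρ.surj y hy).imp fun x hx => ⟨(h₃ x).1 hx.1, hx.2⟩
      · rintro ⟨x, hx, rfl⟩
        rw [hρ.map x ((h₃ x).2 hx)]
        exact (h₃ x).2 hx
  | link x y S T _ h₁ h₂ h₃ =>
    subst h₂
    have hx : (Ctx.empty.set x (some S)).set y (some T) x = some S := by simp [Ctx.set_ne, h₁]
    have hy : (Ctx.empty.set x (some S)).set y (some T) y = some T := by simp
    have hne : ρ x ≠ ρ y := fun h => h₁ (hρ.inj x y (ne hx) (ne hy) h)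
    refine .link _ _ S T _ hne (hρ.eq_of_map (fun z hz => ?_) fun z hz => ?_) h₃
    · by_cases hzy : z = y
      · simp [hzy]
      · by_cases hzx : z = x
        · rw [hzx, hx, Ctx.set_ne _ _ hne, Ctx.set_same]
        · simp [Ctx.set_apply, hzx, hzy] at hz
    · rw [Ctx.set_ne _ _ (hz y (ne hy)).symm, Ctx.set_ne _ _ (hz x (ne hx)).symm]
      rfl
  | cut m n _ Γ₁ Γ₂ S T P Q h₁ h₂ h₃ h₄ =>
    obtain ⟨Γ₁', Γ₂', hs, hρ₁, hρ₂⟩ := hρ.split h₁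
    exact .cut m n _ Γ₁' Γ₂' S T _ _ hs h₂ ⟨_, _, P, hρ₁.cons S, rfl, h₃⟩
      ⟨_, _, Q, hρ₂.cons T, rfl, h₄⟩
  | choiceL m n _ P Q h₁ h₂ => exact .choiceL m n _ _ _ ⟨_, _, P, hρ, rfl, h₁⟩ ⟨_, _, Q, hρ, rfl, h₂⟩
  | choiceR m n _ P Q h₁ h₂ => exact .choiceR m n _ _ _ ⟨_, _, P, hρ, rfl, h₁⟩ ⟨_, _, Q, hρ, rfl, h₂⟩
  | one x _ h₁ =>
    subst h₁
    have hx : (Ctx.empty : Ctx Tag).set x (some (SType.unit .out)) x ≠ none := by simp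
    refine .one _ _ (hρ.eq_of_map (fun z hz => ?_) fun z hz => ?_)
    · by_cases hzx : z = x
      · simp [hzx]
      · simp [Ctx.set_apply, hzx] at hz
    · rw [Ctx.set_ne _ _ (hz x hx).symm]
      rfl
  | bot n x P _ h₁ h₂ =>
    exact .bot n _ _ _ (hρ.map_some h₁) ⟨_, _, P, hρ.set (ne h₁) none, rfl, h₂⟩
  | plus n x P _ I hI ann S k h₁ h₂ =>
    exact .plus n _ _ _ I hI ann S k (hρ.map_some h₁) ⟨_, _, P, hρ.set (ne h₁) _, rfl, h₂⟩
  | amp n x I J hJI P _ hJ ann S h₁ h₂ =>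
    exact .amp n _ I J hJI _ _ hJ ann S (hρ.map_some h₁)
      fun j => ⟨_, _, _, hρ.set (ne h₁) _, rfl, h₂ j⟩
  | tensor m n x P Q _ Γ₁ Γ₂ S T h₁ h₂ h₃ h₄ =>
    obtain ⟨Γ₁', Γ₂', hs, hρ₁, hρ₂⟩ := (hρ.set (ne h₁) none).split h₂
    refine .tensor m n _ _ _ _ Γ₁' Γ₂' S T (hρ.map_some h₁) hs ⟨_, _, P, hρ₁.cons S, rfl, h₃⟩
      ⟨_, _, Q, hρ₂.set_of_fresh (fun y hy hyx => ?_) _, rfl, h₄⟩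
    have hy' := h₂.symm.eq_left hy ▸ hy
    rw [Ctx.set_apply] at hy'
    split_ifs at hy' with hyx'
    · exact absurd rfl hy'
    · exact hρ.inj y x hy' (ne h₁) hyx
  | par n x P _ S T h₁ h₂ =>
    exact .par n _ _ _ S T (hρ.map_some h₁) ⟨_, _, P, (hρ.set (ne h₁) _).cons S, rfl, h₂⟩

end CaP

namespace CaP

variable {Tag Name : Type} {D : Program Tag Name}

namespace Ctx

/-! ### Splitting and subtyping of contexts -/

/-- The union of two contexts with disjoint domains. -/
def union (Γ₁ Γ₂ : Ctx Tag) : Ctx Tag := fun x => (Γ₁ x).or (Γ₂ x)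

theorem union_of_right_none {Γ₁ Γ₂ : Ctx Tag} {x : ℕ} (h : Γ₂ x = none) : union Γ₁ Γ₂ x = Γ₁ x := by
  simp [union, h]

theorem union_of_left_none {Γ₁ Γ₂ : Ctx Tag} {x : ℕ} (h : Γ₁ x = none) : union Γ₁ Γ₂ x = Γ₂ x := by
  simp [union, h]

theorem Split.assoc_left {Γ Γ₁ Γ₂ Γ₃ Γ₄ : Ctx Tag} (h : Split Γ Γ₁ Γ₂) (h' : Split Γ₂ Γ₃ Γ₄) :
    ∃ Δ, Split Γ Δ Γ₄ ∧ Split Δ Γ₁ Γ₃ := by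
  refine ⟨union Γ₁ Γ₃, fun x => ?_, fun x => ?_⟩
  all_goals unfold union; rcases h x with ⟨h₁, h₂⟩ | ⟨h₁, h₂⟩ <;> rcases h' x with ⟨h₃, h₄⟩ | ⟨h₃, h₄⟩ <;> simp_all

theorem Split.assoc_right {Γ Γ₁ Γ₂ Γ₃ Γ₄ : Ctx Tag} (h : Split Γ Γ₁ Γ₂) (h' : Split Γ₁ Γ₃ Γ₄) :
    ∃ Δ, Split Γ Γ₃ Δ ∧ Split Δ Γ₄ Γ₂ :=
  let ⟨Δ, h₁, h₂⟩ := h.symm.assoc_left h'.symm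
  ⟨Δ, h₁.symm, h₂.symm⟩

theorem Split.left_none {Γ Γ₁ Γ₂ : Ctx Tag} (h : Split Γ Γ₁ Γ₂) {x : ℕ} (hx : Γ x = none) :
    Γ₁ x = none :=
  (h x).elim (fun h => h.1.trans hx) And.left

theorem Split.right_none {Γ Γ₁ Γ₂ : Ctx Tag} (h : Split Γ Γ₁ Γ₂) {x : ℕ} (hx : Γ x = none) :
    Γ₂ x = none :=
  h.symm.left_none hx

theorem split_empty_left (Γ : Ctx Tag) : Split Γ empty Γ := fun _ => Or.inr ⟨rfl, rfl⟩

theorem Split.eq_of_empty {Γ Γ₂ : Ctx Tag} (h : Split Γ empty Γ₂) : Γ = Γ₂ :=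
  funext fun x => (h x).elim (fun h => h.1.symm.trans h.2.symm) fun h => h.2.symm

theorem Split.shift {Γ Γ₁ Γ₂ : Ctx Tag} (h : Split Γ Γ₁ Γ₂) :
    Split (shift Γ) (shift Γ₁) (shift Γ₂)
  | 0 => Or.inl ⟨rfl, rfl⟩
  | x + 1 => h x

theorem Split.cons_left {Γ Γ₁ Γ₂ : Ctx Tag} (h : Split Γ Γ₁ Γ₂) (S : SType Tag) :
    Split (cons S Γ) (cons S Γ₁) (Ctx.shift Γ₂)
  | 0 => Or.inl ⟨rfl, rfl⟩
  | x + 1 => h x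

theorem Split.cons_right {Γ Γ₁ Γ₂ : Ctx Tag} (h : Split Γ Γ₁ Γ₂) (S : SType Tag) :
    Split (cons S Γ) (Ctx.shift Γ₁) (cons S Γ₂) :=
  (h.symm.cons_left S).symm

theorem Split.set_left {Γ Γ₁ Γ₂ : Ctx Tag} (h : Split Γ Γ₁ Γ₂) {x : ℕ} (hx : Γ₂ x = none) (o) :
    Split (Γ.set x o) (Γ₁.set x o) Γ₂ := by
  intro y
  by_cases hy : y = x
  · subst hy
    simp [hx]
  · simpa [set_ne _ _ hy] using h y

theorem Split.set_right {Γ Γ₁ Γ₂ : Ctx Tag} (h : Split Γ Γ₁ Γ₂) {x : ℕ} (hx : Γ₁ x = none) (o) :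
    Split (Γ.set x o) Γ₁ (Γ₂.set x o) :=
  (h.symm.set_left hx o).symm

theorem Split.some_left {Γ Γ₁ Γ₂ : Ctx Tag} (h : Split Γ Γ₁ Γ₂) {x : ℕ} {S}
    (hx : Γ₁ x = some S) : Γ x = some S ∧ Γ₂ x = none := by
  rcases h x with ⟨h₁, h₂⟩ | ⟨h₁, -⟩
  · exact ⟨h₁.symm.trans hx, h₂⟩
  · rw [hx] at h₁
    cases h₁

theorem Split.some_right {Γ Γ₁ Γ₂ : Ctx Tag} (h : Split Γ Γ₁ Γ₂) {x : ℕ} {S}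
    (hx : Γ₂ x = some S) : Γ x = some S ∧ Γ₁ x = none :=
  h.symm.some_left hx

theorem split_set_none {Γ Γ₁ Γ₂ : Ctx Tag} (h : Split (Γ.set x none) Γ₁ Γ₂) :
    Γ₁ x = none ∧ Γ₂ x = none :=
  ⟨h.left_none (set_same _ _ _), h.right_none (set_same _ _ _)⟩

theorem Split.of_shift {Γ Γ₁ Γ₂ : Ctx Tag} (h : Split (Ctx.shift Γ) Γ₁ Γ₂) :
    ∃ Δ₁ Δ₂, Γ₁ = Ctx.shift Δ₁ ∧ Γ₂ = Ctx.shift Δ₂ ∧ Split Γ Δ₁ Δ₂ :=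
  ⟨_, _, eq_shift (h.left_none rfl), eq_shift (h.right_none rfl), fun x => h (x + 1)⟩

theorem Le.refl (Γ : Ctx Tag) : Le Γ Γ := by
  intro x
  cases Γ x
  · exact .none
  · exact .some (.refl _)

theorem Le.trans {Γ₁ Γ₂ Γ₃ : Ctx Tag} (h : Le Γ₁ Γ₂) (h' : Le Γ₂ Γ₃) : Le Γ₁ Γ₃ := by
  intro x
  have h₁ := h x
  have h₂ := h' x
  revert h₁ h₂
  generalize Γ₁ x = a, Γ₂ x = b, Γ₃ x = c
  rintro ⟨h₁⟩ ⟨h₂⟩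
  · exact .some (Sub.trans ‹_› ‹_›)
  · exact .none

theorem Le.eq_none {Γ Δ : Ctx Tag} (h : Le Δ Γ) {x : ℕ} (hx : Γ x = none) : Δ x = none := by
  have h := h x
  rw [hx] at h
  generalize Δ x = o at h ⊢
  cases h
  rfl

theorem Le.exists_some {Γ Δ : Ctx Tag} (h : Le Δ Γ) {x : ℕ} {S} (hx : Γ x = some S) :
    ∃ S', Δ x = some S' ∧ Sub S' S := by
  have h := h x
  rw [hx] at h
  generalize Δ x = o at h
  cases h with
  | some h => exact ⟨_, rfl, h⟩

theorem Le.set {Γ Δ : Ctx Tag} (h : Le Δ Γ) (x : ℕ) {o o'} (ho : Option.Rel Sub o o') :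
    Le (Δ.set x o) (Γ.set x o') := by
  intro y
  by_cases hy : y = x
  · subst hy
    simpa using ho
  · simpa [set_ne _ _ hy] using h y

theorem Le.set_some {Γ Δ : Ctx Tag} {x : ℕ} {o} (h : Le Δ (Γ.set x o)) {S S'} (hx : Γ x = some S)
    (hS : Sub S' S) : Le (Δ.set x (some S')) Γ := by
  have := h.set x (.some hS)
  rwa [set_set, set_eq_self hx] at this

theorem Le.exists_cons {Γ Δ : Ctx Tag} {S : SType Tag} (h : Le Δ (cons S Γ)) :
    ∃ S' Δ', Δ = cons S' Δ' ∧ Sub S' S ∧ Le Δ' Γ :=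
  let ⟨S', hS, hsub⟩ := h.exists_some (x := 0) rfl
  ⟨S', _, eq_cons hS, hsub, fun x => h (x + 1)⟩

theorem Split.exists_le {Γ Γ₁ Γ₂ Δ₁ Δ₂ : Ctx Tag} (h : Split Γ Γ₁ Γ₂) (h₁ : Le Δ₁ Γ₁)
    (h₂ : Le Δ₂ Γ₂) : ∃ Δ, Le Δ Γ ∧ Split Δ Δ₁ Δ₂ := by
  refine ⟨union Δ₁ Δ₂, fun x => ?_, fun x => ?_⟩
  · rcases h x with ⟨h₃, h₄⟩ | ⟨h₃, h₄⟩
    · rw [← h₃, union_of_right_none (h₂.eq_none h₄)]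
      exact h₁ x
    · rw [← h₄, union_of_left_none (h₁.eq_none h₃)]
      exact h₂ x
  · rcases h x with ⟨h₃, h₄⟩ | ⟨h₃, h₄⟩
    · exact Or.inl ⟨(union_of_right_none (h₂.eq_none h₄)).symm, h₂.eq_none h₄⟩
    · exact Or.inr ⟨h₁.eq_none h₃, (union_of_left_none (h₁.eq_none h₃)).symm⟩

end Ctx

open Ctx

/-! ### Typing of buffers -/

/-- `BufTyped D B n Γ S T`: on a channel of type `S` the buffer `B` sends messages that use the
channels in `Γ`, after which the channel has type `T`. -/
inductive BufTyped (D : Program Tag Name) :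
    Buf Tag Name → ℕ → Ctx Tag → SType Tag → SType Tag → Prop
  | hole (S : SType Tag) : BufTyped D .hole 0 Ctx.empty S S
  | select {B : Buf Tag Name} {n : ℕ} {Γ : Ctx Tag} {I : Finset Tag} {hI ann}
      {S : {a // a ∈ I} → SType Tag} {T : SType Tag} (k : {a // a ∈ I}) :
      BufTyped D B n Γ (S k) T →
      BufTyped D (.select k.1 B) (1 + ann k + n) Γ (SType.branch .out I hI ann S) T
  | fork {B : Buf Tag Name} {P : Proc Tag Name} {m n : ℕ} {Γ Γ₁ Γ₂ : Ctx Tag} {S T U : SType Tag} :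
      Split Γ Γ₁ Γ₂ → Typed D m (cons S Γ₁) P → BufTyped D B n Γ₂ T U →
      BufTyped D (.fork P B) (1 + m + n) Γ (SType.pair .out S T) U

namespace BufTyped

variable {B : Buf Tag Name} {n : ℕ} {Γ : Ctx Tag} {S T : SType Tag}

theorem ren (h : BufTyped D B n Γ S T) {ρ : ℕ → ℕ} {Γ' : Ctx Tag} (hρ : Ren ρ Γ Γ') :
    BufTyped D (B.ren ρ) n Γ' S T := by
  induction h generalizing Γ' with
  | hole S =>
    rw [hρ.eq_of_map (Γ'' := Ctx.empty) (fun _ h => absurd rfl h) fun _ _ => rfl]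
    exact .hole S
  | select k _ ih => exact .select k (ih hρ)
  | fork h₁ h₂ _ ih =>
    obtain ⟨Γ₁', Γ₂', hs, hρ₁, hρ₂⟩ := hρ.split h₁
    exact .fork hs (h₂.ren (hρ₁.cons _)) (ih hρ₂)

theorem mem_fn (h : BufTyped D B n Γ S T) {x : ℕ} (hx : Γ x ≠ none) : x ∈ B.fn := by
  induction h with
  | hole S => exact absurd rfl hx
  | select k _ ih => exact ih hx
  | fork h₁ h₂ _ ih =>
    rcases h₁ x with ⟨h, -⟩ | ⟨-, h⟩
    · exact Or.inl (h₂.mem_fn (x := x + 1) (ne_of_eq_of_ne h hx))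
    · exact Or.inr (ih (h ▸ hx))

/-- An input that is performed after the messages in a buffer can be anticipated. -/
theorem late (h : BufTyped D B n Γ S T) {σ : Msg Tag} {X : STree Tag}
    (hX : Trans .inp σ S.1 X) :
    ∃ S' T' : SType Tag, S'.1 = X ∧ Trans .inp σ T.1 T'.1 ∧ BufTyped D B n Γ S' T' := by
  induction h generalizing X with
  | hole S => exact ⟨⟨X, hX.regular S.2⟩, ⟨X, hX.regular S.2⟩, rfl, hX, .hole _⟩
  | @select B n Γ I hI ann S T k _ ih =>
    rcases Trans.branch_inv hX with ⟨h, -⟩ | ⟨-, g, rfl, hg⟩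
    · cases h
    · obtain ⟨S', T', hS, hT, hB⟩ := ih (hg k)
      refine ⟨.branch .out I hI ann fun i => ⟨g i, (hg i).regular (S i).2⟩, T', rfl, hT,
        .select k ?_⟩
      rwa [show (⟨g k, (hg k).regular (S k).2⟩ : SType Tag) = S' from Subtype.ext hS.symm]
  | @fork B P m n Γ Γ₁ Γ₂ S T U h₁ h₂ _ ih =>
    rcases Trans.pair_inv hX with ⟨h, -⟩ | ⟨-, V, rfl, hV⟩
    · cases h
    · obtain ⟨T', U', rfl, hT, hB⟩ := ih hV
      exact ⟨.pair .out S T', U', rfl, hT, .fork h₁ h₂ hB⟩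

/-- The messages in a buffer on one side of a composition can be moved to the dual of the other
side, even if the latter is itself preceded by a buffer. -/
theorem drain (h : BufTyped D B n Γ S T) {B' : Buf Tag Name} {n' : ℕ} {Γ' : Ctx Tag}
    {U V : SType Tag} (hSU : Correct S U) (hB : BufTyped D B' n' Γ' U V) :
    ∃ U' V' W, Correct T U' ∧ BufTyped D B' n' Γ' U' V' ∧ Sub W V.dual ∧
      BufTyped D B n Γ W V'.dual := by
  induction h generalizing U V with
  | hole S => exact ⟨U, V, V.dual, hSU, hB, .refl _, .hole _⟩
  | @select B n Γ I hI ann S T k _ ih =>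
    -- The tag sent by the buffer is answered by an input of `U`, and `late` carries this input
    -- across `B'` to `V`.
    obtain ⟨_, X, hX, ⟨⟩, hSX⟩ := STree.Correct.outSim hSU _ _ (Trans.mustBranch k)
    obtain ⟨U₁, V₁, rfl, hV, hB₁⟩ := hB.late hX
    obtain ⟨U', V', W, hT, hB', hW, hBW⟩ := ih hSX hB₁
    -- Seen from the dual, that input is an output of Vᗮ, possibly an early one, and it can be
    -- hoisted to the root of a subtype.
    have hV : Trans .out _ V.dual.1 V₁.dual.1 := hV.dual
    exact ⟨U', V', .select (ann k) k.1 W, hT, hB', .select hV hW,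
      .select (ann := fun _ => ann k) (S := fun _ => W) ⟨k.1, Finset.mem_singleton_self _⟩ hBW⟩
  | @fork B P m n Γ Γ₁ Γ₂ S T U' h₁ h₂ _ ih =>
    obtain ⟨_, X, hX, hσ, hTX⟩ := STree.Correct.outSim hSU _ _ Trans.mustPair
    cases hσ with
    | @chan _ U₀ h₀ =>
      obtain ⟨U₁, V₁, rfl, hV, hB₁⟩ := hB.late hX
      obtain ⟨U', V', W, hT, hB', hW, hBW⟩ := ih hTX hB₁
      have hV : Trans .out _ V.dual.1 V₁.dual.1 := hV.dual
      let U₂ : SType Tag := ⟨U₀, U.2.of_subtree hX.subtree_chan⟩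
      have h₀' : Correct S U₂ := h₀
      -- The payload keeps its original type `S`; from S ⋈ U₂ it is below the dual of `U₂`, which is
      -- what Vᗮ would send.
      exact ⟨U', V', .pair .out S W, hT, hB', .pair (U := U₂.dual) hV h₀'.symm.sub_dual hW, .fork h₁ h₂ hBW⟩

end BufTyped

/-! ### Decomposing and rebuilding processes inside buffers -/

namespace Typed

variable {B : Buf Tag Name} {n : ℕ} {Γ : Ctx Tag} {P : Proc Tag Name} {S T : SType Tag}

/-- Each output contributes its cost and the channels of its payload; reassociating the splits
collects them into one buffer typing. The type of `x` must be supplied because an empty buffer does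
not determine it. -/
theorem plug_inv {x : ℕ} (h : Typed D n Γ (B.plug x P)) (hx : Γ x = some S) :
    ∃ m k Γ₁ Γ₂ T, n = m + k ∧ Split (Γ.set x none) Γ₁ Γ₂ ∧ BufTyped D B m Γ₁ S T ∧
      Typed D k (Γ₂.set x (some T)) P := by
  induction B generalizing n Γ S with
  | hole =>
    refine ⟨0, n, .empty, _, S, (zero_add n).symm, split_empty_left _, .hole S, ?_⟩
    rwa [set_set, set_eq_self hx]
  | select a B ih =>
    cases h.step with
    | plus n _ _ _ I hI ann S' k h₁ h₂ =>
      obtain rfl := Option.some_injective _ (hx.symm.trans h₁)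
      obtain ⟨m, k', Γ₁, Γ₂, T, rfl, hs, hB, hP⟩ := ih h₂ (set_same _ _ _)
      rw [set_set] at hs
      exact ⟨_, k', Γ₁, Γ₂, T, (add_assoc _ _ _).symm, hs, .select k hB, hP⟩
  | fork Q B ih =>
    cases h.step with
    | tensor m n _ _ _ _ Γ₁ Γ₂ S' T h₁ h₂ h₃ h₄ =>
      obtain rfl := Option.some_injective _ (hx.symm.trans h₁)
      obtain ⟨m', k', Γ₃, Γ₄, T, rfl, hs, hB, hP⟩ := ih h₄ (set_same _ _ _)
      rw [set_set, set_eq_self (split_set_none h₂).2] at hs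
      obtain ⟨Δ, hΔ, hΔ'⟩ := h₂.assoc_left hs
      exact ⟨_, k', Δ, Γ₄, T, (add_assoc _ _ _).symm, hΔ, .fork hΔ' h₃ hB, hP⟩

end Typed

theorem BufTyped.plug {B : Buf Tag Name} {m k : ℕ} {Γ Γ₁ Γ₂ : Ctx Tag} {P : Proc Tag Name}
    {S T : SType Tag} {x : ℕ} (hB : BufTyped D B m Γ₁ S T) (hx : Γ x = some S)
    (hs : Split (Γ.set x none) Γ₁ Γ₂) (hP : Typed D k (Γ₂.set x (some T)) P) :
    Typed D (m + k) Γ (B.plug x P) := by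
  induction hB generalizing Γ with
  | hole S =>
    rwa [← hs.eq_of_empty, set_set, set_eq_self hx, ← zero_add k] at hP
  | select j _ ih =>
    rw [add_assoc]
    refine (TypeStep.plus _ _ _ _ _ _ _ _ j hx (ih (set_same _ _ _) ?_ hP)).typed
    rwa [set_set]
  | fork h₁ h₂ _ ih =>
    rw [add_assoc]
    obtain ⟨Δ, hΔ, hΔ'⟩ := hs.assoc_right h₁
    refine (TypeStep.tensor _ _ _ _ _ _ _ Δ _ _ hx hΔ h₂ (ih (set_same _ _ _) ?_ hP)).typed
    rwa [set_set, set_eq_self (split_set_none hΔ).2]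

namespace Typed

variable {B : Buf Tag Name} {n : ℕ} {Γ : Ctx Tag} {P : Proc Tag Name} {S T : SType Tag}

theorem plug_zero_inv (h : Typed D n (cons S Γ) (B.plug 0 P)) :
    ∃ m k Γ₁ Γ₂ T, n = m + k ∧ Split Γ Γ₁ Γ₂ ∧ BufTyped D B m (shift Γ₁) S T ∧
      Typed D k (cons T Γ₂) P := by
  obtain ⟨m, k, Γ₁, Γ₂, T, rfl, hs, hB, hP⟩ := h.plug_inv rfl
  rw [cons_set_zero_none] at hs
  obtain ⟨Δ₁, Δ₂, rfl, rfl, hs'⟩ := hs.of_shift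
  rw [shift_set_zero] at hP
  exact ⟨m, k, Δ₁, Δ₂, T, rfl, hs', hB, hP⟩

end Typed

theorem BufTyped.plug_zero {B : Buf Tag Name} {m k : ℕ} {Γ Γ₁ Γ₂ : Ctx Tag} {P : Proc Tag Name}
    {S T : SType Tag} (hB : BufTyped D B m (shift Γ₁) S T) (hs : Split Γ Γ₁ Γ₂)
    (hP : Typed D k (cons T Γ₂) P) : Typed D (m + k) (cons S Γ) (B.plug 0 P) := by
  refine hB.plug (Γ₂ := shift Γ₂) rfl ?_ ?_
  · rw [cons_set_zero_none]
    exact hs.shift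
  · rwa [shift_set_zero]

/-- The process in a buffer can be replaced by one that is typed in a smaller context. -/
theorem Typed.plug_replace {B : Buf Tag Name} {n : ℕ} {Γ : Ctx Tag} {P : Proc Tag Name} {x : ℕ}
    (h : Typed D n Γ (B.plug x P)) :
    ∃ k m Γ', n = k + m ∧ Typed D m Γ' P ∧ ∀ m' Δ' P', Typed D m' Δ' P' → Le Δ' Γ' →
      ∃ Δ, Le Δ Γ ∧ Typed D (k + m') Δ (B.plug x P') := by
  induction B generalizing n Γ with
  | hole =>
    exact ⟨0, n, Γ, (zero_add n).symm, h, fun m' Δ' P' h h' => ⟨Δ', h', (zero_add m').symm ▸ h⟩⟩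
  | select a B ih =>
    cases h.step with
    | plus n _ _ _ I hI ann S j h₁ h₂ =>
      obtain ⟨k, m, Γ', rfl, hP, hr⟩ := ih h₂
      refine ⟨1 + ann j + k, m, Γ', (add_assoc _ _ _).symm, hP, fun m' Δ' P' h h' => ?_⟩
      obtain ⟨Δ, hΔ, hP'⟩ := hr m' Δ' P' h h'
      obtain ⟨V, hV, hsub⟩ := hΔ.exists_some (set_same _ _ _)
      -- Only the continuation of the selected tag has shrunk, so the others are dropped. Keeping
      -- the annotation `ann j` leaves the cost of the output unchanged.
      refine ⟨Δ.set x (some (.select (ann j) j.1 V)),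
        hΔ.set_some h₁ (.select (Trans.mustBranch j) hsub), ?_⟩
      rw [add_assoc]
      refine (TypeStep.plus _ x _ _ {j.1} _ (fun _ => ann j) (fun _ => V)
        ⟨j.1, Finset.mem_singleton_self _⟩ (set_same _ _ _) ?_).typed
      rwa [set_set, set_eq_self hV]
  | fork Q B ih =>
    cases h.step with
    | tensor l n _ _ _ _ Γ₁ Γ₂ S T h₁ h₂ h₃ h₄ =>
      obtain ⟨k, m, Γ', rfl, hP, hr⟩ := ih h₄
      refine ⟨1 + l + k, m, Γ', (add_assoc _ _ _).symm, hP, fun m' Δ' P' h h' => ?_⟩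
      obtain ⟨Δ, hΔ, hP'⟩ := hr m' Δ' P' h h'
      obtain ⟨V, hV, hsub⟩ := hΔ.exists_some (set_same _ _ _)
      -- The split ignores `x`, so `x` is erased before the smaller context is merged with the
      -- payload's and gets its pair type afterwards.
      have hΔ₂ : Le (Δ.set x none) Γ₂ := by
        have := hΔ.set x (.none (r := Sub))
        rwa [set_set, set_eq_self (split_set_none h₂).2] at this
      obtain ⟨Δ₀, hΔ₀, hs⟩ := h₂.exists_le (.refl Γ₁) hΔ₂
      have hx : Δ₀ x = none := hΔ₀.eq_none (set_same _ _ _)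
      refine ⟨Δ₀.set x (some (.pair .out S V)),
        hΔ₀.set_some h₁ (.pair Trans.mustPair (.refl S) hsub), ?_⟩
      rw [add_assoc]
      refine (TypeStep.tensor l _ x _ _ _ Γ₁ (Δ.set x none) S V (set_same _ _ _) ?_ h₃ ?_).typed
      · rwa [set_set, set_eq_self hx]
      · rwa [set_set, set_eq_self hV]

end CaP

namespace CaP

variable {Tag Name : Type} {D : Program Tag Name}

open Ctx

/-! ### Renamings used by the semantics -/

namespace Ctx

theorem Ren.shift {ρ : ℕ → ℕ} {Γ Γ' : Ctx Tag} (h : Ren ρ Γ Γ') :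
    Ren (lift ρ) (shift Γ) (Ctx.shift Γ') where
  inj
    | 0, _ => fun h _ _ => absurd rfl h
    | _, 0 => fun _ h _ => absurd rfl h
    | x + 1, y + 1 => fun hx hy hxy => congrArg (· + 1) (h.inj x y hx hy (Nat.succ_injective hxy))
  map
    | 0 => fun h => absurd rfl h
    | x + 1 => fun hx => h.map x hx
  surj
    | 0 => fun h => absurd rfl h
    | y + 1 => fun hy =>
      let ⟨x, hx, hxy⟩ := h.surj y hy
      ⟨x + 1, hx, congrArg (· + 1) hxy⟩

theorem ren_succ (Γ : Ctx Tag) : Ren (· + 1) Γ (shift Γ) where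
  inj _ _ _ _ h := Nat.succ_injective h
  map _ _ := rfl
  surj
    | 0 => fun h => absurd rfl h
    | y + 1 => fun hy => ⟨y, hy, rfl⟩

theorem ren_inst (y : ℕ) (Γ : Ctx Tag) : Ren (inst y) (shift Γ) Γ where
  inj
    | 0, _ => fun h _ _ => absurd rfl h
    | _, 0 => fun _ h _ => absurd rfl h
    | _ + 1, _ + 1 => fun _ _ h => congrArg (· + 1) h
  map
    | 0 => fun h => absurd rfl h
    | _ + 1 => fun _ => rfl
  surj y hy := ⟨y + 1, hy, rfl⟩

theorem ren_inst_cons (y : ℕ) (S : SType Tag) {Γ : Ctx Tag} (hy : Γ y = none) :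
    Ren (inst y) (cons S Γ) (Γ.set y (some S)) := by
  have ne : ∀ x, Γ x ≠ none → x ≠ y := by
    rintro x hx rfl
    exact hx hy
  refine ⟨?_, ?_, fun x hx => ?_⟩
  · rintro (_ | x) (_ | x') hx hx' h
    · rfl
    · exact (ne x' hx' h.symm).elim
    · exact (ne x hx h).elim
    · exact congrArg (· + 1) h
  · rintro (_ | x) hx
    · exact set_same _ _ _
    · exact set_ne _ _ (ne x hx)
  · by_cases hxy : x = y
    · exact ⟨0, nofun, hxy.symm⟩
    · rw [set_ne _ _ hxy] at hx
      exact ⟨x + 1, hx, rfl⟩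

theorem ren_swap (S T : SType Tag) (Γ : Ctx Tag) :
    Ren swap (cons S (cons T Γ)) (cons T (cons S Γ)) := by
  have key : ∀ (S T : SType Tag) x, swap (swap x) = x ∧
      cons T (cons S Γ) (swap x) = cons S (cons T Γ) x
    | _, _, 0 => ⟨rfl, rfl⟩
    | _, _, 1 => ⟨rfl, rfl⟩
    | _, _, _ + 2 => ⟨rfl, rfl⟩
  refine Ren.of_leftInverse (fun x _ => key S T x) fun y hy => ⟨(key T S y).1, ?_⟩
  rwa [(key T S y).2]

theorem Split.of_cons {S : SType Tag} {Γ Γ₁ Γ₂ : Ctx Tag} (h : Split (cons S Γ) Γ₁ Γ₂)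
    (h₂ : Γ₂ 0 = none) : ∃ Δ₁ Δ₂, Γ₁ = cons S Δ₁ ∧ Γ₂ = Ctx.shift Δ₂ ∧ Split Γ Δ₁ Δ₂ := by
  refine ⟨_, _, eq_cons ((h 0).elim And.left fun h => ?_), eq_shift h₂, fun x => h (x + 1)⟩
  rw [h₂] at h
  cases h.2

theorem set_comm (Γ : Ctx Tag) {x y : ℕ} (h : x ≠ y) (o o') :
    (Γ.set x o).set y o' = (Γ.set y o').set x o := by
  funext z
  simp only [set_apply]
  split_ifs with h₁ h₂
  · exact (h (h₂.symm.trans h₁)).elim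
  all_goals rfl

end Ctx

theorem inst_comp_succ (y : ℕ) : inst y ∘ (· + 1) = id := rfl

theorem lift_inst_comp_lift_succ (y : ℕ) : lift (inst y) ∘ lift (· + 1) = id := by
  rw [lift_comp, inst_comp_succ, lift_id]

/-! ### Cancelling shifts, and inversion lemmas for typing -/

namespace Typed

variable {n : ℕ} {Γ : Ctx Tag} {P : Proc Tag Name}

theorem cast {m : ℕ} (h : Typed D n Γ P) (e : n = m) : Typed D m Γ P := e ▸ h

/-- `inst 0` undoes the shift; its value 0 at the removed binder is arbitrary, since that index has
no type in the context. -/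
theorem of_ren_succ (h : Typed D n (shift Γ) (P.ren (· + 1))) : Typed D n Γ P := by
  have := h.ren (ren_inst 0 Γ)
  rwa [Proc.ren_ren, inst_comp_succ, Proc.ren_id] at this

theorem of_ren_lift_succ {S : SType Tag} (h : Typed D n (cons S (shift Γ)) (P.ren (lift (· + 1)))) :
    Typed D n (cons S Γ) P := by
  have := h.ren ((ren_inst 0 Γ).cons S)
  rwa [Proc.ren_ren, lift_inst_comp_lift_succ, Proc.ren_id] at this

theorem eq_none_of_notMem_fn (h : Typed D n Γ P) {x : ℕ} (hx : x ∉ P.fn) : Γ x = none :=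
  by_contra fun h' => hx (h.mem_fn h')

theorem hole_or_exists_some {B : Buf Tag Name} {x : ℕ} (h : Typed D n Γ (B.plug x P)) :
    B = .hole ∨ ∃ S, Γ x = some S := by
  cases B with
  | hole => exact Or.inl rfl
  | select => cases h.step with | plus => exact Or.inr ⟨_, ‹_›⟩
  | fork => cases h.step with | tensor => exact Or.inr ⟨_, ‹_›⟩

theorem link_inv {S : SType Tag} {y : ℕ} (h : Typed D n (cons S Γ) (.link 0 (y + 1))) :
    n = 1 ∧ ∃ T, Γ = Ctx.empty.set y (some T) ∧ Sub S.dual T := by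
  generalize hΔ : cons S Γ = Δ at h
  cases h.step with
  | link _ _ S' T _ h₁ h₂ h₃ =>
    subst h₂
    have h₀ := congrFun hΔ 0
    rw [set_ne _ _ h₁, set_same, cons_zero] at h₀
    obtain rfl := Option.some_injective _ h₀
    refine ⟨rfl, T, funext fun x => (congrFun hΔ (x + 1)).trans ?_, h₃⟩
    simp [set_apply]

theorem link_zero {S T : SType Tag} (y : ℕ) (h : Sub S.dual T) :
    Typed D 1 (cons S (Ctx.empty.set y (some T))) (.link 0 (y + 1)) := by
  refine (TypeStep.link 0 (y + 1) S T _ (Nat.succ_ne_zero y).symm ?_ h).typed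
  funext x
  cases x
  · simp [set_apply]
  · simp [set_apply]

theorem cut {m : ℕ} {Γ₁ Γ₂ : Ctx Tag} {S T : SType Tag} {Q : Proc Tag Name} (hs : Split Γ Γ₁ Γ₂)
    (hST : Correct S T) (hP : Typed D m (cons S Γ₁) P) (hQ : Typed D n (cons T Γ₂) Q) :
    Typed D (m + n) Γ (.cut P Q) :=
  (TypeStep.cut m n Γ Γ₁ Γ₂ S T P Q hs hST hP hQ).typed

end Typed

theorem Buf.mem_fn_ren {B : Buf Tag Name} {ρ : ℕ → ℕ} {i : ℕ} (h : i ∈ (B.ren ρ).fn) :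
    ∃ j ∈ B.fn, ρ j = i := by
  induction B with
  | hole => cases h
  | select a B ih => exact ih h
  | fork P B ih =>
    rcases h with h | h
    · obtain ⟨_ | j, hj, h⟩ := Proc.mem_fn_ren h
      · cases h
      · exact ⟨j, Or.inl hj, Nat.succ_injective h⟩
    · exact (ih h).imp fun j h => ⟨Or.inr h.1, h.2⟩

namespace BufTyped

variable {B : Buf Tag Name} {n : ℕ} {Γ : Ctx Tag} {S T : SType Tag}

theorem of_ren_succ (h : BufTyped D (B.ren (· + 1)) n (shift Γ) S T) : BufTyped D B n Γ S T := by
  have := h.ren (ren_inst 0 Γ)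
  rwa [Buf.ren_ren, inst_comp_succ, Buf.ren_id] at this

theorem eq_none_of_notMem_fn (h : BufTyped D B n Γ S T) {x : ℕ} (hx : x ∉ B.fn) : Γ x = none :=
  by_contra fun h' => hx (h.mem_fn h')

end BufTyped

/-! ### Structural pre-congruence -/

/-- A channel owned by the process in the hole is absent from the buffer and from the other side of
the cut, so its type can be updated through both splits. This is what lets an input prefix leave a
cut. -/
theorem Ctx.Split.lift_set {Γ Γ₁ Γ₂ Γ₃ Γ₄ : Ctx Tag} (h : Split Γ Γ₁ Γ₂) (h' : Split Γ₁ Γ₃ Γ₄)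
    {y : ℕ} {S : SType Tag} (hy : Γ₄ y = some S) (o) : Γ y = some S ∧
      Split (Γ.set y o) (Γ₁.set y o) Γ₂ ∧ Split (Γ₁.set y o) Γ₃ (Γ₄.set y o) :=
  have h₁ := h'.some_right hy
  have h₂ := h.some_left h₁.1
  ⟨h₂.1, h.set_left h₂.2 o, h'.set_right h₁.2 o⟩

section PreCong

variable {n : ℕ} {Γ : Ctx Tag} {P Q R : Proc Tag Name} {B B' : Buf Tag Name} {x y : ℕ}

theorem Typed.link_symm (h : Typed D n Γ (.link x y)) : Typed D n Γ (.link y x) := by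
  cases h.step with
  | link _ _ S T _ h₁ h₂ h₃ =>
    exact (TypeStep.link y x T S _ h₁.symm (h₂.trans (set_comm _ h₁ _ _)) h₃.dual_comm).typed

theorem Typed.cut_symm (h : Typed D n Γ (.cut P Q)) : Typed D n Γ (.cut Q P) := by
  cases h.step with
  | cut m n _ Γ₁ Γ₂ S T _ _ hs hST hP hQ =>
    exact (Typed.cut hs.symm hST.symm hQ hP).cast (add_comm _ _)

theorem Typed.pull_wait (h : Typed D n Γ (.cut (B.plug 0 (.wait (y + 1) P)) Q)) :
    Typed D n Γ (.wait y (.cut (B.plug 0 P) Q)) := by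
  cases h.step with
  | cut m n _ Γ₁ Γ₂ S T _ _ hs hST hP hQ =>
    obtain ⟨m, k, Γ₃, Γ₄, S₀, rfl, hs', hB, hW⟩ := hP.plug_zero_inv
    cases hW.step with
    | bot _ _ _ _ h₁ h₂ =>
      rw [cons_set_succ] at h₂
      obtain ⟨hy, hs₁, hs₂⟩ := hs.lift_set hs' h₁ none
      exact (TypeStep.bot _ _ _ _ hy (.cut hs₁ hST (hB.plug_zero hs₂ h₂) hQ)).typed

theorem Typed.pull_case {I : Finset Tag} {P : {a // a ∈ I} → Proc Tag Name}
    (h : Typed D n Γ (.cut (B.plug 0 (.case (y + 1) I P)) Q)) :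
    Typed D n Γ (.case y I fun a => .cut (B.plug 0 (P a)) Q) := by
  cases h.step with
  | cut m n _ Γ₁ Γ₂ S T _ _ hs hST hP hQ =>
    obtain ⟨m, k, Γ₃, Γ₄, S₀, rfl, hs', hB, hW⟩ := hP.plug_zero_inv
    cases hW.step with
    | amp _ _ _ J hJI _ _ hJ ann U h₁ h₂ =>
      refine (TypeStep.amp _ _ I J hJI _ _ hJ ann U (hs.lift_set hs' h₁ none).1 fun j => ?_).typed
      obtain ⟨-, hs₁, hs₂⟩ := hs.lift_set hs' h₁ (some (U j))
      have h₃ := h₂ j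
      rw [cons_set_succ] at h₃
      exact (Typed.cut hs₁ hST (hB.plug_zero hs₂ h₃) hQ).cast (by omega)

theorem Typed.pull_join (h : Typed D n Γ (.cut (B.plug 0 (.join (y + 1) P)) Q)) :
    Typed D n Γ (.join y (.cut ((B.ren (lift (· + 1))).plug 0 (P.ren swap))
      (Q.ren (lift (· + 1))))) := by
  cases h.step with
  | cut m n _ Γ₁ Γ₂ S T _ _ hs hST hP hQ =>
    obtain ⟨m, k, Γ₃, Γ₄, S₀, rfl, hs', hB, hW⟩ := hP.plug_zero_inv
    cases hW.step with
    | par _ _ _ _ U V h₁ h₂ =>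
      rw [cons_set_succ] at h₂
      obtain ⟨hy, hs₁, hs₂⟩ := hs.lift_set hs' h₁ (some V)
      exact (TypeStep.par _ _ _ _ U V hy (.cut (hs₁.cons_left U) hST
        ((hB.ren (ren_succ _).shift).plug_zero (hs₂.cons_right U) (h₂.ren (ren_swap _ _ _)))
        (hQ.ren ((ren_succ _).cons T)))).typed

/-- This is the pre-congruence axiom that changes types: `drain` lets the messages of `B` leave on
`y`, whose type shrinks to a `W` that starts with exactly these messages. -/
theorem Typed.pull_link (h : Typed D n Γ (.cut (B.plug 0 P) (B'.plug 0 (.link 0 (y + 1))))) :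
    ∃ Δ, Le Δ Γ ∧
      Typed D n Δ ((B.ren (inst y)).plug y (.cut P (B'.plug 0 (.link 0 (y + 1))))) := by
  cases h.step with
  | cut m n _ Γ₁ Γ₂ S T _ _ hs hST hP hQ =>
    obtain ⟨m, k, Γ₃, Γ₄, S₀, rfl, hs₁, hB, hP⟩ := hP.plug_zero_inv
    obtain ⟨m', k', Γ₅, Γ₆, T₀, rfl, hs₂, hB', hL⟩ := hQ.plug_zero_inv
    obtain ⟨rfl, U, rfl, hU⟩ := hL.link_inv
    obtain ⟨T', T₀', W, hST', hB'', hW, hBW⟩ := hB.drain hST hB'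
    obtain ⟨Δ, hs₃, hs₄⟩ := hs.assoc_right hs₁
    obtain ⟨hy₁, hy₂⟩ := hs₂.some_right (set_same _ _ _)
    obtain ⟨hy₃, hy₄⟩ := hs₄.some_right hy₁
    obtain ⟨hy₅, hy₆⟩ := hs₃.some_right hy₃
    -- Once the messages of `B` have gone, the link is retyped with exactly dual ends.
    have hs₅ := hs₂.set_right hy₂ (some T₀'.dual)
    rw [set_set] at hs₅
    -- `W` is below the dual of `T₀` by `drain`, and that dual is below the declared type `U` of `y`
    -- by the link rule.
    have hle := (Le.refl (Γ.set y none)).set_some hy₅ (hW.trans hU)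
    rw [set_set] at hle
    refine ⟨Γ.set y (some W), hle, ?_⟩
    refine (BufTyped.plug (hBW.ren (ren_inst y _)) (set_same _ _ _)
      (Γ₂ := Δ.set y none) ?_ (.cut (Γ₁ := Γ₄) (Γ₂ := Γ₂.set y (some T₀'.dual)) ?_ hST' hP
        (hB''.plug_zero hs₅ (.link_zero y (.refl _))))).cast (add_assoc _ _ _).symm
    · rw [set_set]
      exact hs₃.set_right hy₆ none
    · rw [set_set]
      exact hs₄.set_right hy₄ _

theorem Typed.pull_fork (h : Typed D n Γ (.cut (.fork (y + 1) P (Q.ren (· + 1))) R)) :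
    Typed D n Γ (.fork y (.cut (P.ren swap) (R.ren (lift (· + 1)))) Q) := by
  cases h.step with
  | cut m n _ Γ₁ Γ₂ S T _ _ hs hST hP hR =>
    cases hP.step with
    | tensor m k _ _ _ _ Γ₃ Γ₄ U V h₁ h₂ h₃ h₄ =>
      -- The continuation is a shifted process and cannot mention the cut channel, so the cut
      -- channel belongs to the payload.
      have h₀ : Γ₄ 0 = none := by
        rw [← set_ne Γ₄ (some V) (Nat.succ_ne_zero y).symm]
        refine h₄.eq_none_of_notMem_fn fun h => ?_
        obtain ⟨j, -, hj⟩ := Proc.mem_fn_ren h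
        exact Nat.succ_ne_zero j hj
      rw [cons_set_succ] at h₂
      obtain ⟨Γ₃, Γ₄, rfl, rfl, hs'⟩ := h₂.of_cons h₀
      rw [shift_set_succ] at h₄
      obtain ⟨hy, hy'⟩ := hs.some_left h₁
      obtain ⟨Δ, hΔ, hΔ'⟩ := (hs.set_left hy' none).assoc_right hs'.symm
      exact (TypeStep.tensor _ _ _ _ _ _ Δ Γ₄ U V hy hΔ.symm
        (.cut (hΔ'.cons_left U) hST (h₃.ren (ren_swap _ _ _)) (hR.ren ((ren_succ _).cons T)))
        h₄.of_ren_succ).typed.cast (by omega)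

theorem Typed.pull_buffer (h : Typed D n Γ (.cut ((B.ren (· + 1)).plug (y + 1) P) Q)) :
    Typed D n Γ (B.plug y (.cut P Q)) := by
  cases h.step with
  | cut m n _ Γ₁ Γ₂ S T _ _ hs hST hP hQ =>
    rcases hP.hole_or_exists_some with hB | ⟨U, hU⟩
    · cases B with
      | hole => exact h
      | select => cases hB
      | fork => cases hB
    · obtain ⟨m, k, Γ₃, Γ₄, V, rfl, hs', hB, hP⟩ := hP.plug_inv hU
      have h₀ : Γ₃ 0 = none := by
        refine hB.eq_none_of_notMem_fn fun h => ?_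
        obtain ⟨j, -, hj⟩ := Buf.mem_fn_ren h
        exact Nat.succ_ne_zero j hj
      rw [cons_set_succ] at hs'
      obtain ⟨Γ₄, Γ₃, rfl, rfl, hs''⟩ := hs'.symm.of_cons h₀
      rw [cons_set_succ] at hP
      obtain ⟨hy, hy'⟩ := hs.some_left hU
      obtain ⟨Δ, hΔ, hΔ'⟩ := (hs.set_left hy' none).assoc_right hs''.symm
      exact (hB.of_ren_succ.plug hy hΔ (.cut (hΔ'.set_left hy' _) hST hP hQ)).cast
        (add_assoc _ _ _).symm

/-- Since `x` is not free in `Q`, its residual type `T` is used in the payload, and the buffer can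
follow it there. An empty buffer, which need not give `x` a type, is treated apart. -/
theorem Typed.pull_fork_buffer (hxy : x ≠ y) (hx : x ∉ Q.fn)
    (h : Typed D n Γ (B.plug x (.fork y P Q))) :
    Typed D n Γ (.fork y ((B.ren (· + 1)).plug (x + 1) P) Q) := by
  rcases h.hole_or_exists_some with rfl | ⟨S, hS⟩
  · exact h
  obtain ⟨m, k, Γ₁, Γ₂, T, rfl, hs, hB, hF⟩ := h.plug_inv hS
  have h₂x := (split_set_none hs).2
  cases hF.step with
  | tensor k l _ _ _ _ Γ₃ Γ₄ U V h₁ h₂ h₃ h₄ =>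
    rw [set_ne _ _ hxy.symm] at h₁
    have h₄x : Γ₄ x = none := by
      rw [← set_ne Γ₄ (some V) hxy]
      exact h₄.eq_none_of_notMem_fn hx
    have h₃x : Γ₃ x = some T := by
      rcases h₂ x with ⟨h, -⟩ | ⟨-, h⟩
      · rw [h, set_ne _ _ hxy, set_same]
      · rw [set_ne _ _ hxy, set_same, h₄x] at h
        cases h
    obtain ⟨hy, h₁y⟩ := hs.some_right h₁
    rw [set_ne _ _ hxy.symm] at hy
    have hs₁ := h₂.set_left h₄x none
    rw [set_comm _ hxy.symm, set_set, set_eq_self h₂x] at hs₁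
    obtain ⟨Δ, hΔ, hΔ'⟩ := (hs.set_right h₁y none).assoc_left hs₁
    have hΔx : Δ x = none := hΔ.left_none (by rw [set_ne _ _ hxy, set_same])
    have hs₂ := hΔ.set_left h₄x (some S)
    rw [set_comm _ hxy.symm, set_set, set_eq_self hS] at hs₂
    refine (TypeStep.tensor (m + k) l _ _ _ _ _ Γ₄ U V hy hs₂
      ((hB.ren (ren_succ _)).plug (Γ := cons U (Δ.set x (some S))) (x := x + 1) (set_same _ _ _)
        (Γ₂ := cons U (Γ₃.set x none)) ?_ ?_) h₄).typed.cast (by omega)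
    · rw [cons_set_succ, set_set, set_eq_self hΔx]
      exact hΔ'.cons_right U
    · rwa [cons_set_succ, set_set, set_eq_self h₃x]

theorem Typed.buffer_comm (hxy : x ≠ y) (hx : x ∉ B'.fn)
    (h : Typed D n Γ (B.plug x (B'.plug y P))) : Typed D n Γ (B'.plug y (B.plug x P)) := by
  rcases h.hole_or_exists_some with rfl | ⟨S, hS⟩
  · exact h
  obtain ⟨m, k, Γ₁, Γ₂, T, rfl, hs, hB, hF⟩ := h.plug_inv hS
  rcases hF.hole_or_exists_some with rfl | ⟨U, hU⟩
  · exact h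
  have h₂x := (split_set_none hs).2
  obtain ⟨l, k, Γ₃, Γ₄, V, rfl, hs', hB', hP⟩ := hF.plug_inv hU
  rw [set_ne _ _ hxy.symm] at hU
  have h₃x := hB'.eq_none_of_notMem_fn hx
  have h₄x : Γ₄ x = some T := by
    rcases hs' x with ⟨h, -⟩ | ⟨-, h⟩
    · rw [set_ne _ _ hxy, set_same, h₃x] at h
      cases h
    · rw [h, set_ne _ _ hxy, set_same]
  obtain ⟨hy, h₁y⟩ := hs.some_right hU
  rw [set_ne _ _ hxy.symm] at hy
  have hs₁ := hs'.set_right h₃x none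
  rw [set_comm _ hxy.symm, set_set, set_eq_self h₂x] at hs₁
  obtain ⟨Δ, hΔ, hΔ'⟩ := (hs.set_right h₁y none).symm.assoc_right hs₁
  have hΔx : Δ x = none := hΔ.right_none (by rw [set_ne _ _ hxy, set_same])
  have hs₂ := hΔ.set_right h₃x (some S)
  rw [set_comm _ hxy.symm, set_set, set_eq_self hS] at hs₂
  have hs₃ := hΔ'.set_left h₁y (some V)
  refine (hB'.plug hy hs₂ (hB.plug (k := k) (by rw [set_ne _ _ hxy, set_same])
    (Γ₂ := (Γ₄.set x none).set y (some V)) ?_ ?_)).cast (by omega)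
  · rw [set_comm _ hxy.symm, set_set, set_eq_self hΔx]
    exact hs₃.symm
  · rwa [set_comm _ hxy.symm, set_set, set_eq_self h₄x]

end PreCong

/-- Among the axioms, only unfolding a name can lower the measure, by discarding the slack in its
rule, and only moving a buffer across a link changes the context. -/
theorem PreCong.typed {P Q : Proc Tag Name} (h : PreCong D P Q) :
    ∀ {n : ℕ} {Γ : Ctx Tag}, Typed D n Γ P → ∃ m Δ, m ≤ n ∧ Le Δ Γ ∧ Typed D m Δ Q := by
  have same : ∀ {n : ℕ} {Γ : Ctx Tag} {Q : Proc Tag Name}, Typed D n Γ Q →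
      ∃ m Δ, m ≤ n ∧ Le Δ Γ ∧ Typed D m Δ Q := fun h => ⟨_, _, le_rfl, .refl _, h⟩
  induction h with
  | refl P => exact same
  | trans _ _ ih₁ ih₂ =>
    intro n Γ h
    obtain ⟨m, Δ, hm, hΔ, h⟩ := ih₁ h
    obtain ⟨m', Δ', hm', hΔ', h⟩ := ih₂ h
    exact ⟨m', Δ', hm'.trans hm, hΔ'.trans hΔ, h⟩
  | cut _ _ ih₁ ih₂ =>
    intro n Γ h
    cases h.step with
    | cut m n _ Γ₁ Γ₂ S T _ _ hs hST hP hQ =>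
      obtain ⟨m', _, hm, hΔ, hP⟩ := ih₁ hP
      obtain ⟨n', _, hn, hΔ', hQ⟩ := ih₂ hQ
      obtain ⟨S', Δ₁, rfl, hS, hΔ₁⟩ := hΔ.exists_cons
      obtain ⟨T', Δ₂, rfl, hT, hΔ₂⟩ := hΔ'.exists_cons
      obtain ⟨Δ, hΔ, hs⟩ := hs.exists_le hΔ₁ hΔ₂
      exact ⟨m' + n', Δ, add_le_add hm hn, hΔ, .cut hs (hST.mono hS hT) hP hQ⟩
  | buffer B x _ ih =>
    intro n Γ h
    obtain ⟨k, m, Γ', rfl, hP, hr⟩ := h.plug_replace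
    obtain ⟨m', Δ', hm, hΔ', hP'⟩ := ih hP
    obtain ⟨Δ, hΔ, h⟩ := hr _ _ _ hP' hΔ'
    exact ⟨k + m', Δ, Nat.add_le_add_left hm k, hΔ, h⟩
  | sCall A xs hA =>
    intro n Γ h
    cases h.step with
    | call m n _ _ _ h₁ h₂ h₃ h₄ => exact ⟨n, Γ, Nat.le_add_left n m, .refl _, h₄⟩
  | sLink x y => exact fun h => same h.link_symm
  | sComm P Q => exact fun h => same h.cut_symm
  | sWait B y P Q => exact fun h => same h.pull_wait
  | sCase B y I P Q => exact fun h => same h.pull_case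
  | sJoin B y P Q => exact fun h => same h.pull_join
  | sPull0 B B' y P =>
    exact fun h =>
      let ⟨Δ, hΔ, h⟩ := h.pull_link
      ⟨_, Δ, le_rfl, hΔ, h⟩
  | sPull1 y P Q R _ => exact fun h => same h.pull_fork
  | sPull2 B y P Q => exact fun h => same h.pull_buffer
  | sPull3 B x y P Q hxy _ hx => exact fun h => same (h.pull_fork_buffer hxy hx)
  | sPull4 B B' x y P hxy _ hx => exact fun h => same (h.buffer_comm hxy hx)

end CaP

namespace CaP

variable {Tag Name : Type} {D : Program Tag Name}

open Ctx

/-! ### Subject reduction -/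

section BaseComm

variable {n : ℕ} {Γ : Ctx Tag} {P Q : Proc Tag Name} {B : Buf Tag Name}

theorem Typed.cut_link {y : ℕ} (h : Typed D n Γ (.cut (.link 0 (y + 1)) P)) :
    ∃ m Δ, m < n ∧ Le Δ Γ ∧ Typed D m Δ (P.ren (inst y)) := by
  cases h.step with
  | cut m n _ Γ₁ Γ₂ S T _ _ hs hST hL hP =>
    obtain ⟨rfl, U, rfl, hU⟩ := hL.link_inv
    obtain ⟨hy, hy'⟩ := hs.some_left (set_same _ _ _)
    -- The link owns `y` and nothing else, so without `y` the context is the one of the other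
    -- process.
    have hΓ : Γ.set y none = Γ₂ := by
      have := hs.set_left hy' none
      rw [set_set, set_eq_self (empty_apply y)] at this
      exact this.eq_of_empty
    have hle := (Le.refl (Γ.set y none)).set_some hy (hST.sub_dual.trans hU)
    rw [hΓ] at hle
    exact ⟨n, _, Nat.lt_add_of_pos_left one_pos, hle, hP.ren (ren_inst_cons y T hy')⟩

theorem Typed.cut_close (h : Typed D n Γ (.cut (.close 0) (.wait 0 (P.ren (· + 1))))) :
    ∃ m < n, Typed D m Γ P := by
  cases h.step with
  | cut m n _ Γ₁ Γ₂ S T _ _ hs hST hC hW =>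
    generalize hΔ : cons S Γ₁ = Δ at hC
    cases hC.step with
    | one _ _ h₁ =>
      cases hW.step with
      | bot _ _ _ _ h₂ h₃ =>
        rw [cons_set_zero_none] at h₃
        obtain rfl : Γ₁ = Ctx.empty := funext fun x => congrFun (hΔ.trans h₁) (x + 1)
        exact ⟨n, Nat.lt_add_of_pos_left one_pos, hs.eq_of_empty ▸ h₃.of_ren_succ⟩

/-- Labels carry annotations, so sender and receiver agree on the number attached to the tag. What
the sender paid beyond 1 is what the selected branch may spend. -/
theorem Typed.cut_select {a : Tag} {I : Finset Tag} {Q : {a // a ∈ I} → Proc Tag Name} (ha : a ∈ I)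
    (h : Typed D n Γ (.cut (.select 0 a P) (B.plug 0 (.case 0 I Q)))) :
    ∃ m < n, Typed D m Γ (.cut P (B.plug 0 (Q ⟨a, ha⟩))) := by
  cases h.step with
  | cut m n _ Γ₁ Γ₂ S T _ _ hs hST hP hQ =>
    obtain ⟨l, k, Γ₃, Γ₄, T₀, rfl, hs', hB, hC⟩ := hQ.plug_zero_inv
    cases hP.step with
    | plus m _ _ _ I' hI' ann U j h₁ h₂ =>
      obtain rfl := Option.some_injective _ h₁
      rw [cons_set_zero] at h₂
      obtain ⟨_, X, hX, ⟨⟩, hUX⟩ := STree.Correct.outSim hST _ _ (Trans.mustBranch j)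
      obtain ⟨T', T₀', rfl, hT, hB'⟩ := hB.late hX
      cases hC.step with
      | amp _ _ _ J hJI _ _ hJ ann' V h₃ h₄ =>
        obtain rfl := Option.some_injective _ h₃
        rcases Trans.branch_inv hT with ⟨-, i, hi, hV⟩ | ⟨h, -⟩
        · injection hi with hm ha
          obtain rfl : T₀' = V i := Subtype.ext hV
          have h₅ := h₄ i
          rw [cons_set_zero, show (⟨i.1, hJI i.2⟩ : {a // a ∈ I}) = ⟨j.1, ‹_›⟩ from
            Subtype.ext ha.symm] at h₅
          exact ⟨_, by omega, .cut hs hUX h₂ (hB'.plug_zero hs' h₅)⟩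
        · cases h

theorem Typed.cut_fork {R : Proc Tag Name}
    (h : Typed D n Γ (.cut (.fork 0 (P.ren (lift (· + 1))) Q) (B.plug 0 (.join 0 R)))) :
    ∃ m < n, Typed D m Γ (.cut P (.cut (Q.ren (lift (· + 1)))
      ((B.ren (lift (· + 1))).plug 0 (R.ren swap)))) := by
  cases h.step with
  | cut m n _ Γ₁ Γ₂ S T _ _ hs hST hF hJ =>
    obtain ⟨l, k, Γ₃, Γ₄, T₀, rfl, hs', hB, hR⟩ := hJ.plug_zero_inv
    cases hF.step with
    | tensor m m' _ _ _ _ Γ₅ Γ₆ U V h₁ h₂ hP hQ =>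
      obtain rfl := Option.some_injective _ h₁
      rw [cons_set_zero_none] at h₂
      obtain ⟨Γ₅, Γ₆, rfl, rfl, hs₁⟩ := h₂.of_shift
      rw [shift_set_zero] at hQ
      obtain ⟨_, X, hX, hσ, hVX⟩ := STree.Correct.outSim hST _ _ Trans.mustPair
      obtain ⟨T', T₀', rfl, hT, hB'⟩ := hB.late hX
      cases hR.step with
      | par _ _ _ _ U' V' h₃ hR =>
        obtain rfl := Option.some_injective _ h₃
        rw [cons_set_zero] at hR
        rcases Trans.pair_inv hT with ⟨-, rfl, hV⟩ | ⟨h, -⟩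
        · obtain rfl : T₀' = V' := Subtype.ext hV
          cases hσ with
          | chan hU =>
            obtain ⟨Δ, hΔ, hΔ'⟩ := hs.assoc_right hs₁
            exact ⟨m + (m' + (l + k)), by omega, .cut hΔ hU hP.of_ren_lift_succ
              (.cut (hΔ'.cons_right U') hVX (hQ.ren ((ren_succ _).cons V))
                ((hB'.ren (ren_succ _).shift).plug_zero (hs'.cons_right U')
                  (hR.ren (ren_swap _ _ _))))⟩
        · cases h

end BaseComm

/-! ### Closing the base reductions under cuts, buffers and pre-congruence -/

theorem BaseComm.typed {P Q : Proc Tag Name} (h : BaseComm P Q) {n : ℕ} {Γ : Ctx Tag}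
    (hP : Typed D n Γ P) : ∃ m Δ, m < n ∧ Le Δ Γ ∧ Typed D m Δ Q := by
  have same : ∀ {Q : Proc Tag Name}, (∃ m < n, Typed D m Γ Q) →
      ∃ m Δ, m < n ∧ Le Δ Γ ∧ Typed D m Δ Q := fun ⟨m, hm, h⟩ => ⟨m, Γ, hm, .refl _, h⟩
  cases h with
  | rLink y P => exact hP.cut_link
  | rClose P => exact same hP.cut_close
  | rSelect B a P I Q ha => exact same (hP.cut_select ha)
  | rFork B P Q R => exact same hP.cut_fork

/-- The left process of a cut can be replaced by one that is typed in a smaller context. -/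
theorem Typed.cut_replace {n : ℕ} {Γ : Ctx Tag} {P Q : Proc Tag Name}
    (h : Typed D n Γ (.cut P Q)) :
    ∃ m k Γ', n = m + k ∧ Typed D m Γ' P ∧ ∀ m' Δ' P', Typed D m' Δ' P' → Le Δ' Γ' →
      ∃ Δ, Le Δ Γ ∧ Typed D (m' + k) Δ (.cut P' Q) := by
  cases h.step with
  | cut m n _ Γ₁ Γ₂ S T _ _ hs hST hP hQ =>
    refine ⟨m, n, _, rfl, hP, fun m' Δ' P' hP' hΔ' => ?_⟩
    obtain ⟨S', Δ₁, rfl, hS, hΔ₁⟩ := hΔ'.exists_cons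
    obtain ⟨Δ, hΔ, hs⟩ := hs.exists_le hΔ₁ (.refl Γ₂)
    exact ⟨Δ, hΔ, .cut hs (hST.mono hS (.refl T)) hP' hQ⟩

theorem CommRed.typed {P Q : Proc Tag Name} (h : CommRed D P Q) :
    ∀ {n : ℕ} {Γ : Ctx Tag}, Typed D n Γ P → ∃ m Δ, m < n ∧ Le Δ Γ ∧ Typed D m Δ Q := by
  induction h with
  | base h => exact h.typed
  | rCut R _ ih =>
    intro n Γ h
    obtain ⟨m, k, Γ', rfl, hP, hr⟩ := h.cut_replace
    obtain ⟨m', Δ', hm, hΔ', hP'⟩ := ih hP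
    obtain ⟨Δ, hΔ, h⟩ := hr _ _ _ hP' hΔ'
    exact ⟨_, Δ, Nat.add_lt_add_right hm k, hΔ, h⟩
  | rBuffer B x _ ih =>
    intro n Γ h
    obtain ⟨k, m, Γ', rfl, hP, hr⟩ := h.plug_replace
    obtain ⟨m', Δ', hm, hΔ', hP'⟩ := ih hP
    obtain ⟨Δ, hΔ, h⟩ := hr _ _ _ hP' hΔ'
    exact ⟨_, Δ, Nat.add_lt_add_left hm k, hΔ, h⟩
  | rStr hp _ ih =>
    intro n Γ h
    obtain ⟨m, Δ, hm, hΔ, h⟩ := hp.typed h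
    obtain ⟨m', Δ', hm', hΔ', h⟩ := ih h
    exact ⟨m', Δ', hm'.trans_le hm, hΔ'.trans hΔ, h⟩

/-- Typing both reducts at once keeps the disjunction of bounds stable: a surrounding cut or buffer
adds the same amount on both sides. It also covers the choice that does not lower the measure. -/
theorem ChoiceRed.typed {P Q₁ Q₂ : Proc Tag Name} (h : ChoiceRed D P Q₁ Q₂) :
    ∀ {n : ℕ} {Γ : Ctx Tag}, Typed D n Γ P → ∃ m₁ m₂ Δ₁ Δ₂, (m₁ < n ∨ m₂ < n) ∧
      Le Δ₁ Γ ∧ Le Δ₂ Γ ∧ Typed D m₁ Δ₁ Q₁ ∧ Typed D m₂ Δ₂ Q₂ := by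
  induction h with
  | rChoice P Q =>
    intro n Γ h
    cases h.step with
    | choiceL m n _ _ _ h₁ h₂ =>
      exact ⟨m, n, Γ, Γ, Or.inl (by omega), .refl _, .refl _, h₁, h₂⟩
    | choiceR m n _ _ _ h₁ h₂ =>
      exact ⟨m, n, Γ, Γ, Or.inr (by omega), .refl _, .refl _, h₁, h₂⟩
  | rCut R _ ih =>
    intro n Γ h
    obtain ⟨m, k, Γ', rfl, hP, hr⟩ := h.cut_replace
    obtain ⟨m₁, m₂, Δ₁, Δ₂, hm, hΔ₁, hΔ₂, h₁, h₂⟩ := ih hP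
    obtain ⟨Δ₁', hΔ₁', h₁⟩ := hr _ _ _ h₁ hΔ₁
    obtain ⟨Δ₂', hΔ₂', h₂⟩ := hr _ _ _ h₂ hΔ₂
    exact ⟨_, _, Δ₁', Δ₂', by omega, hΔ₁', hΔ₂', h₁, h₂⟩
  | rBuffer B x _ ih =>
    intro n Γ h
    obtain ⟨k, m, Γ', rfl, hP, hr⟩ := h.plug_replace
    obtain ⟨m₁, m₂, Δ₁, Δ₂, hm, hΔ₁, hΔ₂, h₁, h₂⟩ := ih hP
    obtain ⟨Δ₁', hΔ₁', h₁⟩ := hr _ _ _ h₁ hΔ₁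
    obtain ⟨Δ₂', hΔ₂', h₂⟩ := hr _ _ _ h₂ hΔ₂
    exact ⟨_, _, Δ₁', Δ₂', by omega, hΔ₁', hΔ₂', h₁, h₂⟩
  | rStr hp _ ih =>
    intro n Γ h
    obtain ⟨m, Δ, hm, hΔ, h⟩ := hp.typed h
    obtain ⟨m₁, m₂, Δ₁, Δ₂, hm', hΔ₁, hΔ₂, h₁, h₂⟩ := ih h
    exact ⟨m₁, m₂, Δ₁, Δ₂, by omega, hΔ₁.trans hΔ, hΔ₂.trans hΔ, h₁, h₂⟩

end CaP

theorem mainTheorem1 {Tag Name : Type} (D : CaP.Program Tag Name) (P : CaP.Proc Tag Name)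
    (n : ℕ) (Γ : CaP.Ctx Tag) (hP : CaP.Typed D n Γ P) :
    (∀ Q, CaP.Red D P Q → ∃ m Δ, CaP.Ctx.Le Δ Γ ∧ CaP.Typed D m Δ Q) ∧
    (∀ Q, CaP.CommRed D P Q → ∃ m Δ, m < n ∧ CaP.Ctx.Le Δ Γ ∧ CaP.Typed D m Δ Q) ∧
    (∀ Q₁ Q₂, CaP.ChoiceRed D P Q₁ Q₂ →
      (∃ m Δ, m < n ∧ CaP.Ctx.Le Δ Γ ∧ CaP.Typed D m Δ Q₁) ∨
      (∃ m Δ, m < n ∧ CaP.Ctx.Le Δ Γ ∧ CaP.Typed D m Δ Q₂)) := by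
  refine ⟨fun Q h => ?_, fun Q h => h.typed hP, fun Q₁ Q₂ h => ?_⟩
  · rcases (CaP.red_iff D P Q).1 h with h | ⟨R, h | h⟩
    · obtain ⟨m, Δ, -, hΔ, hQ⟩ := h.typed hP
      exact ⟨m, Δ, hΔ, hQ⟩
    · obtain ⟨m, -, Δ, -, -, hΔ, -, hQ, -⟩ := h.typed hP
      exact ⟨m, Δ, hΔ, hQ⟩
    · obtain ⟨-, m, -, Δ, -, -, hΔ, -, hQ⟩ := h.typed hP
      exact ⟨m, Δ, hΔ, hQ⟩
  · obtain ⟨m₁, m₂, Δ₁, Δ₂, hm, hΔ₁, hΔ₂, h₁, h₂⟩ := h.typed hP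
    exact hm.imp (fun hm => ⟨m₁, Δ₁, hm, hΔ₁, h₁⟩) fun hm => ⟨m₂, Δ₂, hm, hΔ₂, h₂⟩
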